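/- **Setting.** For each sample size $n$ the complete data $X=(X_{\mathrm{obs}},X_{\mathrm{mis}})$ have a strictly positive probability density $f_n(\cdot\mid\psi)$, $\psi\in\Psi$, with $\Psi\subseteq\mathbb R^h$ open; $\psi^\star\in\Psi$ is the true value. Let $\theta:\mathbb R^h\to\mathbb R^k$ with $k\ge1$, and consider $H_0:\theta(\psi^\star)=\theta_0$. Given $X_{\mathrm{obs}}$, the values $X^1_{\mathrm{mis}},\dots,X^m_{\mathrm{mis}}$ are drawn independently from an imputation kernel; put $X^\ell=(X_{\mathrm{obs}},X^\ell_{\mathrm{mis}})$, $L^\ell(\psi)=\log f_n(X^\ell\mid\psi)$ and $\overline L(\psi^1,\dots,\psi^m)=\frac1m\sum_{\ell=1}^m L^\ell(\psi^\ell)$, $\overline L(\psi)=\overline L(\psi,\dots,\psi)$. Let $\widehat\psi^\ell=\widehat\psi(X^\ell)$ be the complete-data MLE computed from $X^\ell$, $\widehat\psi_{\mathrm{obs}}$ the observed-data MLE, $\widehat\psi^*$ a maximizer of $\overline L$ over $\Psi$ and $\widehat\psi_0^*$ a maximizer of $\overline L$ over $\{\psi\in\Psi:\theta(\psi)=\theta_0\}$.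 These estimators are measurable and $\Psi$-valued, and the maximizers exist almost surely for all large $n$. Define $$\widehat d=2\{\overline L(\widehat\psi^*)-\overline L(\widehat\psi_0^*)\},\qquad \widehat r^{\mathrm{rob}}=\frac{m+1}{h(m-1)}\bigl\{2\overline L(\widehat\psi^1,\dots,\widehat\psi^m)-2\overline L(\widehat\psi^*)\bigr\},\qquad \widehat D^{\mathrm{rob}}=\frac{\widehat d}{k(1+\widehat r^{\mathrm{rob}})} .$$ **Conditions $\mathrm{RC}_\psi$.** Write $\underline I_n(\psi;x)=-n^{-1}\partial^2\log f_n(x\mid\psi)/\partial\psi\,\partial\psi^{\mathsf T}$. 1. (a) $\psi\mapsto\log f_n(x\mid\psi)$ is twice continuously differentiable on $\Psi$ for all $n$, $x$. (b) For all large $n$, almost surely, the complete-data MLE of $X$, and that of each $X^\ell$, is the unique zero in $\Psi$ of the gradient of the corresponding log-likelihood. (c) There is a positive definite matrix $\underline{\mathcal I}=\mathcal U^{-1}$ with $\underline I_n(\psi^\star;X)\to\underline{\mathcal I}$ in probability. (d) $\sqrt n(\widehat\psi_{\mathrm{obs}}-\psi^\star)\Rightarrow\mathcal N_h(0,\mathcal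 T)$. 2. The imputation is proper: with $\mathcal B=\mathcal T-\mathcal U$, the conditional law of $\sqrt n(\widehat\psi^\ell-\widehat\psi_{\mathrm{obs}})$ given $X_{\mathrm{obs}}$ converges weakly, in probability, to $\mathcal N_h(0,\mathcal B)$ (the point mass at $0$ if $\mathcal B=0$), and $\mathcal T^{-1}\{\underline I_n(\widehat\psi^\ell;X^\ell)^{-1}-\mathcal U\}\to0$ in probability for each $\ell$. 3. (Equal fraction of missing information of $\psi$.) There is $r\ge0$ with $\mathcal T=(1+r)\,\mathcal U$. 4. (Standard smoothness and consistency conditions.) $\theta$ is $C^1$ near $\psi^\star$ with Jacobian of rank $k$ at $\psi^\star$. For each $\ell$, the maps $\psi\mapsto\underline I_n(\psi;X^\ell)$ are asymptotically equicontinuous in probability at $\psi^\star$: for all $\varepsilon,\eta>0$ there is $\delta>0$ such that, for all large $n$, $P\bigl(\exists\,\psi\in\Psi,\ |\psi-\psi^\star|<\delta,\ \max_{i,j}|\underline I_n(\psi;X^\ell)_{ij}-\underline I_n(\psi^\star;X^\ell)_{ij}|\ge\varepsilon\bigr)\le\eta$. For each $\ell$, $\psi^\star$ is asymptotically a well-separated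 maximizer: for every $\varepsilon>0$ there is $\delta>0$ with $P\bigl(\exists\,\psi\in\Psi,\ |\psi-\psi^\star|\ge\varepsilon,\ n^{-1}L^\ell(\psi)>n^{-1}L^\ell(\psi^\star)-\delta\bigr)\to0$. **Theorem.** Assume $\mathrm{RC}_\psi$ and $m>1$, and put $r_m=(1+1/m)\,r$. Under $H_0$, as $n\to\infty$ with $m$ fixed, $$\widehat D^{\mathrm{rob}}\ \Rightarrow\ \frac{(1+r_m)M_1}{1+r_mM_3},$$ where $M_1\sim\chi^2_k/k$ and $M_3\sim\chi^2_{h(m-1)}/\{h(m-1)\}$ are independent. -/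

import Mathlib

open MeasureTheory ProbabilityTheory Filter Topology
open scoped ENNReal BoundedContinuousFunction

noncomputable section

namespace MILRT

/-- The law `χ²_d`: the sum of squares of `d` independent standard normal variables. -/
def chiSquared (d : ℕ) : Measure ℝ :=
  (Measure.pi (fun _ : Fin d => gaussianReal 0 1)).map (fun z => ∑ i, z i ^ 2)

/-- Sampling model for the complete data `X = (X_obs, X_mis)` of `n` observations, `n ∈ ℕ`:
a family of strictly positive probability densities `f_n(· ∣ ψ)`, `ψ ∈ Ψ`, with respect to a
reference measure on `𝒪 n × ℳ n`. No row structure or independence is imposed. The reference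
measure of the missing part may depend on the observed part (this allows random missingness
patterns). -/
structure SamplingModel (h : ℕ) (𝒪 ℳ : ℕ → Type*)
    [∀ n, MeasurableSpace (𝒪 n)] [∀ n, MeasurableSpace (ℳ n)] where
  /-- the parameter space `Ψ ⊆ ℝ^h` -/
  Ψ : Set (EuclideanSpace ℝ (Fin h))
  isOpen_Ψ : IsOpen Ψ
  refObs : ∀ n, Measure (𝒪 n)
  sigmaFinite_refObs : ∀ n, SigmaFinite (refObs n)
  refMis : ∀ n, Kernel (𝒪 n) (ℳ n)
  isSFiniteKernel_refMis : ∀ n, IsSFiniteKernel (refMis n)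
  /-- `f n ψ x` is the density `f_n(x ∣ ψ)` -/
  f : ∀ n, EuclideanSpace ℝ (Fin h) → 𝒪 n × ℳ n → ℝ
  measurable_f : ∀ n, ∀ ψ ∈ Ψ, Measurable (f n ψ)
  f_pos : ∀ n, ∀ ψ ∈ Ψ, ∀ x, 0 < f n ψ x
  lintegral_f : ∀ n, ∀ ψ ∈ Ψ,
    ∫⁻ x, ENNReal.ofReal (f n ψ x) ∂((refObs n) ⊗ₘ (refMis n)) = 1

namespace SamplingModel

variable {h : ℕ} {𝒪 ℳ : ℕ → Type*} [∀ n, MeasurableSpace (𝒪 n)] [∀ n, MeasurableSpace (ℳ n)]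

/-- The law of the complete data `X` under the parameter `ψ`. -/
def completeLaw (S : SamplingModel h 𝒪 ℳ) (n : ℕ) (ψ : EuclideanSpace ℝ (Fin h)) :
    Measure (𝒪 n × ℳ n) :=
  ((S.refObs n) ⊗ₘ (S.refMis n)).withDensity (fun x => ENNReal.ofReal (S.f n ψ x))

/-- The law of the observed data `X_obs` under the parameter `ψ`. -/
def obsLaw (S : SamplingModel h 𝒪 ℳ) (n : ℕ) (ψ : EuclideanSpace ℝ (Fin h)) :
    Measure (𝒪 n) :=
  (S.completeLaw n ψ).fst

/-- The observed-data likelihood: the complete-data density with the missing part integrated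
out. -/
def obsLik (S : SamplingModel h 𝒪 ℳ) (n : ℕ) (ψ : EuclideanSpace ℝ (Fin h)) (x : 𝒪 n) : ℝ≥0∞ :=
  ∫⁻ y, ENNReal.ofReal (S.f n ψ (x, y)) ∂(S.refMis n x)

/-- The complete-data log-likelihood `log f_n(x ∣ ψ)`. -/
def loglik (S : SamplingModel h 𝒪 ℳ) (n : ℕ) (x : 𝒪 n × ℳ n) (ψ : EuclideanSpace ℝ (Fin h)) : ℝ :=
  Real.log (S.f n ψ x)

/-- The observed information per observation,
`-n⁻¹ ∂² log f_n(x ∣ ψ) / ∂ψ ∂ψᵀ`. -/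
def obsInfo (S : SamplingModel h 𝒪 ℳ) (n : ℕ) (x : 𝒪 n × ℳ n) (ψ : EuclideanSpace ℝ (Fin h)) :
    Matrix (Fin h) (Fin h) ℝ :=
  Matrix.of fun i j => -((n : ℝ)⁻¹ * iteratedFDeriv ℝ 2 (S.loglik n x) ψ
    ![EuclideanSpace.single i 1, EuclideanSpace.single j 1])

/-- The average `m⁻¹ ∑_ℓ log f_n(X^ℓ ∣ ψ^ℓ)` of the log-likelihoods of `m` completed data sets,
each with its own parameter value. -/
def avgLoglik (S : SamplingModel h 𝒪 ℳ) {m : ℕ} (n : ℕ) (X : Fin m → 𝒪 n × ℳ n)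
    (ψ : Fin m → EuclideanSpace ℝ (Fin h)) : ℝ :=
  (m : ℝ)⁻¹ * ∑ ℓ, S.loglik n (X ℓ) (ψ ℓ)

end SamplingModel

/-- The estimators that enter the procedure, as `Ψ`-valued measurable functions of the data.
That they are the maximizers they should be is part of `RegularityConditions`. -/
structure Estimators {h : ℕ} {𝒪 ℳ : ℕ → Type*} [∀ n, MeasurableSpace (𝒪 n)]
    [∀ n, MeasurableSpace (ℳ n)] (S : SamplingModel h 𝒪 ℳ) (m : ℕ) where
  /-- the complete-data MLE `ψ̂(X)` -/
  mle : ∀ n, 𝒪 n × ℳ n → EuclideanSpace ℝ (Fin h)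
  /-- the observed-data MLE `ψ̂_obs(X_obs)` -/
  obsMle : ∀ n, 𝒪 n → EuclideanSpace ℝ (Fin h)
  /-- `ψ̂^*(X^1, …, X^m)`, the maximizer of the averaged log-likelihood -/
  avgMle : ∀ n, (Fin m → 𝒪 n × ℳ n) → EuclideanSpace ℝ (Fin h)
  /-- `ψ̂_0^*(X^1, …, X^m)`, the maximizer of the averaged log-likelihood under `θ(ψ) = θ₀` -/
  avgMle₀ : ∀ n, (Fin m → 𝒪 n × ℳ n) → EuclideanSpace ℝ (Fin h)
  measurable_mle : ∀ n, Measurable (mle n)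
  measurable_obsMle : ∀ n, Measurable (obsMle n)
  measurable_avgMle : ∀ n, Measurable (avgMle n)
  measurable_avgMle₀ : ∀ n, Measurable (avgMle₀ n)
  mle_mem : ∀ n x, mle n x ∈ S.Ψ
  obsMle_mem : ∀ n x, obsMle n x ∈ S.Ψ
  avgMle_mem : ∀ n X, avgMle n X ∈ S.Ψ
  avgMle₀_mem : ∀ n X, avgMle₀ n X ∈ S.Ψ

namespace Estimators

variable {h : ℕ} {𝒪 ℳ : ℕ → Type*} [∀ n, MeasurableSpace (𝒪 n)] [∀ n, MeasurableSpace (ℳ n)]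
  {S : SamplingModel h 𝒪 ℳ} {m : ℕ}

/-- `d̂ = 2 {L̄(ψ̂^*) - L̄(ψ̂_0^*)}`. -/
def dHat (e : Estimators S m) (n : ℕ) (X : Fin m → 𝒪 n × ℳ n) : ℝ :=
  2 * (S.avgLoglik n X (fun _ => e.avgMle n X) - S.avgLoglik n X (fun _ => e.avgMle₀ n X))

/-- `δ̄ = 2 L̄(ψ̂^1, …, ψ̂^m)`, where `ψ̂^ℓ = ψ̂(X^ℓ)`. -/
def deltaBar (e : Estimators S m) (n : ℕ) (X : Fin m → 𝒪 n × ℳ n) : ℝ :=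
  2 * S.avgLoglik n X (fun ℓ => e.mle n (X ℓ))

/-- `δ̂ = 2 L̄(ψ̂^*, …, ψ̂^*)`. -/
def deltaHat (e : Estimators S m) (n : ℕ) (X : Fin m → 𝒪 n × ℳ n) : ℝ :=
  2 * S.avgLoglik n X (fun _ => e.avgMle n X)

/-- The robust estimator `r̂^rob = (m + 1) / (h (m - 1)) * (δ̄ - δ̂)`. -/
def rHatRob (e : Estimators S m) (n : ℕ) (X : Fin m → 𝒪 n × ℳ n) : ℝ :=
  ((m : ℝ) + 1) / ((h : ℝ) * ((m : ℝ) - 1)) * (e.deltaBar n X - e.deltaHat n X)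

/-- The robust test statistic `D̂^rob = d̂ / (k (1 + r̂^rob))`, `k` the dimension of `θ`. -/
def DHatRob (e : Estimators S m) (k : ℕ) (n : ℕ) (X : Fin m → 𝒪 n × ℳ n) : ℝ :=
  e.dHat n X / ((k : ℝ) * (1 + e.rHatRob n X))

end Estimators

/-- Multiple imputation at the true parameter value `ψstar`, for each sample size `n`, on the
probability space `(Ω n, P n)`: the observed data follow the sampling model, and, given `X_obs`,
the imputed values `X_mis^1, …, X_mis^m` are independent draws from an imputation kernel. -/
structure MultipleImputation {h : ℕ} {𝒪 ℳ : ℕ → Type*} [∀ n, MeasurableSpace (𝒪 n)]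
    [∀ n, MeasurableSpace (ℳ n)] (S : SamplingModel h 𝒪 ℳ) (m : ℕ)
    (ψstar : EuclideanSpace ℝ (Fin h)) {Ω : ℕ → Type*} [∀ n, MeasurableSpace (Ω n)]
    (P : ∀ n, Measure (Ω n)) where
  Xobs : ∀ n, Ω n → 𝒪 n
  Xmis : ∀ n, Fin m → Ω n → ℳ n
  measurable_Xobs : ∀ n, Measurable (Xobs n)
  measurable_Xmis : ∀ n ℓ, Measurable (Xmis n ℓ)
  /-- the imputation model `[X_mis^ℓ ∣ X_obs]` -/
  imp : ∀ n, Kernel (𝒪 n) (ℳ n)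
  isMarkovKernel_imp : ∀ n, IsMarkovKernel (imp n)
  joint_law : ∀ n (A : Set (𝒪 n)) (B : Fin m → Set (ℳ n)), MeasurableSet A →
    (∀ ℓ, MeasurableSet (B ℓ)) →
    P n {ω | Xobs n ω ∈ A ∧ ∀ ℓ, Xmis n ℓ ω ∈ B ℓ} =
      ∫⁻ x in A, ∏ ℓ, imp n x (B ℓ) ∂(S.obsLaw n ψstar)

/-- The completed data sets `X^ℓ = (X_obs, X_mis^ℓ)`, `ℓ = 1, …, m`. -/
def MultipleImputation.completed {h : ℕ} {𝒪 ℳ : ℕ → Type*} [∀ n, MeasurableSpace (𝒪 n)]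
    [∀ n, MeasurableSpace (ℳ n)] {S : SamplingModel h 𝒪 ℳ} {m : ℕ}
    {ψstar : EuclideanSpace ℝ (Fin h)} {Ω : ℕ → Type*} [∀ n, MeasurableSpace (Ω n)]
    {P : ∀ n, Measure (Ω n)} (I : MultipleImputation S m ψstar P) (n : ℕ) (ω : Ω n) :
    Fin m → 𝒪 n × ℳ n :=
  fun ℓ => (I.Xobs n ω, I.Xmis n ℓ ω)

/-- `ψ̂` lies in `Ψ`, maximizes `L` on `Ψ`, and is the unique zero of the gradient of `L` in `Ψ`. -/
def IsUniqueScoreMaximizer {h : ℕ} (Ψ : Set (EuclideanSpace ℝ (Fin h)))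
    (L : EuclideanSpace ℝ (Fin h) → ℝ) (ψhat : EuclideanSpace ℝ (Fin h)) : Prop :=
  ψhat ∈ Ψ ∧ IsMaxOn L Ψ ψhat ∧ ∀ ψ ∈ Ψ, fderiv ℝ L ψ = 0 ↔ ψ = ψhat

/-- The regularity conditions on the sampling model, the estimators, the imputations and the
hypothesis map `θ`. All asymptotic covariance matrices are multiplied by `n`: `info` is the limit
of the observed information per observation, `𝒰 = info⁻¹` the asymptotic covariance of the
complete-data MLE, `𝒯` that of the observed-data MLE, and `ℬ = 𝒯 - 𝒰` the between-imputation
covariance. -/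
structure RegularityConditions {h k m : ℕ} {𝒪 ℳ : ℕ → Type*} [∀ n, MeasurableSpace (𝒪 n)]
    [∀ n, MeasurableSpace (ℳ n)] (S : SamplingModel h 𝒪 ℳ) (e : Estimators S m)
    {ψstar : EuclideanSpace ℝ (Fin h)} {Ω : ℕ → Type*} [∀ n, MeasurableSpace (Ω n)]
    (P : ∀ n, Measure (Ω n)) [∀ n, IsProbabilityMeasure (P n)]
    (I : MultipleImputation S m ψstar P)
    (θ : EuclideanSpace ℝ (Fin h) → EuclideanSpace ℝ (Fin k)) (θ₀ : EuclideanSpace ℝ (Fin k))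
    (info 𝒯 : Matrix (Fin h) (Fin h) ℝ) (r : ℝ) : Prop where
  ψstar_mem : ψstar ∈ S.Ψ
  /-- `θ` is continuously differentiable near `ψstar` ... -/
  contDiffAt_θ : ContDiffAt ℝ 1 θ ψstar
  /-- ... with Jacobian of full rank `k` there. -/
  surjective_fderiv_θ : Function.Surjective (fderiv ℝ θ ψstar)
  /-- The log-likelihood is twice continuously differentiable. -/
  contDiffOn_loglik : ∀ n x, ContDiffOn ℝ 2 (S.loglik n x) S.Ψ
  /-- The complete-data MLE is the unique solution of the likelihood equation, both for the
  complete data `X` ... -/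
  mle_complete : ∀ᶠ n in atTop, ∀ᵐ x ∂(S.completeLaw n ψstar),
    IsUniqueScoreMaximizer S.Ψ (S.loglik n x) (e.mle n x)
  /-- ... and for the completed data sets `X^ℓ`. -/
  mle_completed : ∀ᶠ n in atTop, ∀ᵐ ω ∂(P n), ∀ ℓ,
    IsUniqueScoreMaximizer S.Ψ (S.loglik n (I.completed n ω ℓ)) (e.mle n (I.completed n ω ℓ))
  isMaxOn_obsMle : ∀ᶠ n in atTop, ∀ᵐ ω ∂(P n),
    IsMaxOn (fun ψ => S.obsLik n ψ (I.Xobs n ω)) S.Ψ (e.obsMle n (I.Xobs n ω))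
  isMaxOn_avgMle : ∀ᶠ n in atTop, ∀ᵐ ω ∂(P n),
    IsMaxOn (fun ψ => S.avgLoglik n (I.completed n ω) (fun _ => ψ)) S.Ψ
      (e.avgMle n (I.completed n ω))
  isMaxOn_avgMle₀ : ∀ᶠ n in atTop, ∀ᵐ ω ∂(P n),
    θ (e.avgMle₀ n (I.completed n ω)) = θ₀ ∧
    IsMaxOn (fun ψ => S.avgLoglik n (I.completed n ω) (fun _ => ψ)) {ψ ∈ S.Ψ | θ ψ = θ₀}
      (e.avgMle₀ n (I.completed n ω))
  /-- The observed information at the true value converges in probability to a positive definite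
  matrix. -/
  posDef_info : info.PosDef
  tendsto_obsInfo : ∀ i j, ∀ ε > 0, Tendsto (fun n => S.completeLaw n ψstar
    {x | ε ≤ |S.obsInfo n x ψstar i j - info i j|}) atTop (𝓝 0)
  /-- Asymptotic normality of the observed-data MLE: `√n (ψ̂_obs - ψstar) ⇒ N(0, 𝒯)`. -/
  obsMle_normal : TendstoInDistribution
    (fun (n : ℕ) ω => √(n : ℝ) • (e.obsMle n (I.Xobs n ω) - ψstar)) atTop
    (id : EuclideanSpace ℝ (Fin h) → EuclideanSpace ℝ (Fin h)) P (multivariateGaussian 0 𝒯)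
  /-- Proper imputation, first part: `[√n (ψ̂^ℓ - ψ̂_obs) ∣ X_obs] ⇒ N(0, 𝒯 - 𝒰)`, that is, the
  conditional laws converge weakly, in probability. -/
  imp_normal : ∀ g : EuclideanSpace ℝ (Fin h) →ᵇ ℝ, ∀ ε > 0, Tendsto (fun n : ℕ =>
    S.obsLaw n ψstar {x | ε ≤
      |(∫ y, g (√(n : ℝ) • (e.mle n (x, y) - e.obsMle n x)) ∂(I.imp n x))
        - ∫ z, g z ∂(multivariateGaussian 0 (𝒯 - info⁻¹))|}) atTop (𝓝 0)
  /-- Proper imputation, second part: `𝒯⁻¹ (U^ℓ - 𝒰)` tends to zero in probability, where `U^ℓ`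
  is the inverse of the observed information of `X^ℓ` at its MLE `ψ̂^ℓ`. -/
  imp_lower_order : ∀ ℓ i j, ∀ ε > 0, Tendsto (fun n => P n {ω | ε ≤
    |(𝒯⁻¹ * ((S.obsInfo n (I.completed n ω ℓ) (e.mle n (I.completed n ω ℓ)))⁻¹ - info⁻¹)) i j|})
    atTop (𝓝 0)
  /-- The observed information of the completed data sets is asymptotically equicontinuous in
  probability at `ψstar`. -/
  obsInfo_equicontinuous : ∀ ℓ, ∀ ε > 0, ∀ η > 0, ∃ δ > 0, ∀ᶠ n in atTop,
    P n {ω | ∃ ψ ∈ S.Ψ, dist ψ ψstar < δ ∧ ∃ i j,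
      ε ≤ |S.obsInfo n (I.completed n ω ℓ) ψ i j - S.obsInfo n (I.completed n ω ℓ) ψstar i j|} ≤ η
  /-- `ψstar` is asymptotically a well-separated maximizer of the log-likelihoods of the completed
  data sets (the usual condition for consistency of maximum likelihood). -/
  well_separated : ∀ ℓ, ∀ ε > 0, ∃ δ > 0, Tendsto (fun n : ℕ => P n {ω | ∃ ψ ∈ S.Ψ,
    ε ≤ dist ψ ψstar ∧ (n : ℝ)⁻¹ * S.loglik n (I.completed n ω ℓ) ψ >
      (n : ℝ)⁻¹ * S.loglik n (I.completed n ω ℓ) ψstar - δ}) atTop (𝓝 0)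
  /-- Equal fraction of missing information of `ψ`: `𝒯 = (1 + r) 𝒰`. -/
  r_nonneg : 0 ≤ r
  efmi : 𝒯 = (1 + r) • info⁻¹

end MILRT

end

/-! Choose linear coordinates `T` with `‖T v‖² = vᵀ info v`, and put `x = √n T(ψ - ψ⋆)`, `a_ℓ = √n
T(ψ̂^ℓ - ψ⋆)`. Each completed-data log-likelihood is nearly quadratic around its own maximizer, so
`2{L^ℓ(ψ̂^ℓ) - L^ℓ(ψ)}` equals `‖x - a_ℓ‖²` up to a small relative error. Averaging over `ℓ` gives
`spread a + ‖x - mean a‖²` (`mean_norm_sq_sub`). The free minimum of this paraboloid is `spread a`.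
Over the null set, which near `ψ⋆` is almost its tangent space `N`, the minimum is larger by the
squared distance from `mean a` to `N`. Hence `δ̄ - δ̂ ≈ spread a` and `d̂ ≈ ‖P_{Nᗮ} (mean a)‖²`
(`statistics_near`), and the statistic is within `o_P(1)` of `limitStat` (`tendsto_DHatRob_sub`).
Since only minimal values are compared, mere consistency of `ψ̂^*` and `ψ̂_0^*` suffices; no
expansion of these two estimators is needed.

The `a_ℓ` are sums of a base part, from `ψ̂_obs - ψ⋆`, and deviations `ψ̂^ℓ - ψ̂_obs` that are
conditionally independent given `X_obs`. Equal fractions of missing information make both limiting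
covariances multiples of `𝒰`, so the one map `T` whitens both, and the parts converge jointly to
`√(1+r) g₀` and `√r g_ℓ` with independent standard Gaussian `g₀, …, g_m`
(`RegularityConditions.tendsto_stack`). Then continuous mapping applies.

In the limit, `mean a = √(1+r) g₀ + √r ḡ` has coordinate variance `1 + r + r/m = 1 + r_m`, and
`spread a = (r/m) ∑ ‖g_ℓ - ḡ‖²`. The mean is independent of the deviations from it, `Nᗮ` has
dimension `k` and the deviations fill a space of dimension `h(m-1)`, which yields the two
independent chi-squared variables (`stdGaussian_map_quadratic_forms`, `map_limitStat_eq`). -/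

noncomputable section

set_option linter.unusedSectionVars false

namespace MILRT

open scoped RealInnerProductSpace MatrixOrder Matrix

/-! ### Quadratic forms of standard Gaussian vectors and chi-squared laws -/

section Gaussian

variable {E E₁ E₂ : Type*}
  [NormedAddCommGroup E] [InnerProductSpace ℝ E] [FiniteDimensional ℝ E] [MeasurableSpace E]
  [BorelSpace E]
  [NormedAddCommGroup E₁] [InnerProductSpace ℝ E₁] [FiniteDimensional ℝ E₁] [MeasurableSpace E₁]
  [BorelSpace E₁]
  [NormedAddCommGroup E₂] [InnerProductSpace ℝ E₂] [FiniteDimensional ℝ E₂] [MeasurableSpace E₂]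
  [BorelSpace E₂]

instance isProbabilityMeasure_chiSquared (d : ℕ) : IsProbabilityMeasure (chiSquared d) := by
  unfold chiSquared
  exact Measure.isProbabilityMeasure_map (Measurable.aemeasurable (by fun_prop))

/-- Parseval: `stdGaussian` has independent standard normal coordinates in an orthonormal basis. -/
lemma stdGaussian_map_norm_sq :
    (stdGaussian E).map (fun x => ‖x‖ ^ 2) = chiSquared (Module.finrank ℝ E) := by
  rw [stdGaussian, Measure.map_map (by fun_prop) (by fun_prop), chiSquared]
  congr 1
  ext x
  have := (stdOrthonormalBasis ℝ E).sum_sq_norm_inner_right (∑ i, x i • stdOrthonormalBasis ℝ E i)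
  simp only [Function.comp]
  rw [← this]
  refine Finset.sum_congr rfl fun i _ => ?_
  rw [(stdOrthonormalBasis ℝ E).orthonormal.inner_right_fintype]
  simp

/-- Images of a standard Gaussian vector under the adjoints of two isometries with orthogonal
ranges are independent standard Gaussian vectors. -/
lemma stdGaussian_map_prodMk (T₁ : E →L[ℝ] E₁) (T₂ : E →L[ℝ] E₂) (J₁ : E₁ → E) (J₂ : E₂ → E)
    (h₁ : ∀ x a, ⟪T₁ x, a⟫ = ⟪x, J₁ a⟫) (h₂ : ∀ x a, ⟪T₂ x, a⟫ = ⟪x, J₂ a⟫)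
    (hJ : ∀ a b, ‖J₁ a + J₂ b‖ ^ 2 = ‖a‖ ^ 2 + ‖b‖ ^ 2) :
    (stdGaussian E).map (fun x => (T₁ x, T₂ x)) = (stdGaussian E₁).prod (stdGaussian E₂) := by
  have : IsProbabilityMeasure ((stdGaussian E).map (fun x => (T₁ x, T₂ x))) :=
    Measure.isProbabilityMeasure_map (Measurable.aemeasurable (by fun_prop))
  rw [← charFun_eq_prod_iff]
  intro t
  -- The joint characteristic function at `(a, b)` is that of the standard Gaussian at `J₁ a + J₂
  -- b`; by `hJ` the squared norm in its exponent splits, so it factorizes.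
  have key : ∀ x : E, ⟪WithLp.toLp 2 (T₁ x, T₂ x), t⟫ = ⟪x, J₁ t.fst + J₂ t.snd⟫ := by
    intro x
    rw [WithLp.prod_inner_apply, inner_add_right, ← h₁, ← h₂]
    rfl
  have := charFun_stdGaussian (J₁ t.fst + J₂ t.snd)
  rw [charFun_apply] at this
  rw [charFun_apply, integral_map (by fun_prop) (by fun_prop),
    integral_map (by fun_prop) (by fun_prop)]
  simp_rw [key]
  rw [this, charFun_stdGaussian, charFun_stdGaussian, ← Complex.exp_add]
  norm_cast
  rw [hJ]
  congr 1
  change -(‖t.fst‖ ^ 2 + ‖t.snd‖ ^ 2) / 2 = -‖t.fst‖ ^ 2 / 2 + -‖t.snd‖ ^ 2 / 2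
  ring

lemma stdGaussian_map_norm_sq_prodMk (T₁ : E →L[ℝ] E₁) (T₂ : E →L[ℝ] E₂) (J₁ : E₁ → E)
    (J₂ : E₂ → E)
    (h₁ : ∀ x a, ⟪T₁ x, a⟫ = ⟪x, J₁ a⟫) (h₂ : ∀ x a, ⟪T₂ x, a⟫ = ⟪x, J₂ a⟫)
    (hJ : ∀ a b, ‖J₁ a + J₂ b‖ ^ 2 = ‖a‖ ^ 2 + ‖b‖ ^ 2) :
    (stdGaussian E).map (fun x => (‖T₁ x‖ ^ 2, ‖T₂ x‖ ^ 2)) =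
      (chiSquared (Module.finrank ℝ E₁)).prod (chiSquared (Module.finrank ℝ E₂)) := by
  rw [← stdGaussian_map_norm_sq, ← stdGaussian_map_norm_sq,
    Measure.map_prod_map _ _ (by fun_prop) (by fun_prop),
    ← stdGaussian_map_prodMk T₁ T₂ J₁ J₂ h₁ h₂ hJ, Measure.map_map (by fun_prop) (by fun_prop)]
  rfl

/-- A vector together with `m` further ones, with the Euclidean structure of the direct sum. -/
abbrev Stack (m : ℕ) (E : Type*) := PiLp 2 (fun _ : Option (Fin m) => E)

variable {m : ℕ}

/-- The mean of the `m` further vectors. -/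
def stackMean (m : ℕ) (E : Type*) [NormedAddCommGroup E] [InnerProductSpace ℝ E] :
    Stack m E →L[ℝ] E :=
  (m : ℝ)⁻¹ • ∑ ℓ : Fin m, PiLp.proj (𝕜 := ℝ) 2 (fun _ : Option (Fin m) => E) (some ℓ)

lemma stackMean_apply (x : Stack m E) : stackMean m E x = (m : ℝ)⁻¹ • ∑ ℓ, x (some ℓ) := by
  simp [stackMean]

/-- The vectors with vanishing base component whose further components sum to zero. -/
def contrasts (m : ℕ) (E : Type*) [NormedAddCommGroup E] [InnerProductSpace ℝ E] :
    Submodule ℝ (Stack m E) :=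
  LinearMap.ker ((PiLp.proj (𝕜 := ℝ) 2 (fun _ : Option (Fin m) => E) none :
    Stack m E →ₗ[ℝ] E).prod (∑ ℓ : Fin m, (PiLp.proj (𝕜 := ℝ) 2 (fun _ : Option (Fin m) => E)
      (some ℓ) : Stack m E →ₗ[ℝ] E)))

lemma mem_contrasts {x : Stack m E} : x ∈ contrasts m E ↔ x none = 0 ∧ ∑ ℓ, x (some ℓ) = 0 := by
  simp [contrasts]

/-- Rank-nullity: the defining map sends `m + 1` copies of `E` onto two copies. It is onto because
for `0 < m` a prescribed sum can be placed in a single component. -/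
lemma finrank_contrasts (hm : 0 < m) :
    Module.finrank ℝ (contrasts m E) = Module.finrank ℝ E * (m - 1) := by
  have := LinearMap.finrank_range_add_finrank_ker
    ((PiLp.proj (𝕜 := ℝ) 2 (fun _ : Option (Fin m) => E) none :
    Stack m E →ₗ[ℝ] E).prod (∑ ℓ : Fin m, (PiLp.proj (𝕜 := ℝ) 2 (fun _ : Option (Fin m) => E)
      (some ℓ) : Stack m E →ₗ[ℝ] E)))
  rw [LinearMap.range_eq_top.2] at this
  · rw [finrank_top, Module.finrank_prod,
      (WithLp.linearEquiv 2 ℝ (Option (Fin m) → E)).finrank_eq, Module.finrank_pi_fintype] at this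
    simp only [Finset.sum_const, Finset.card_univ, Fintype.card_option, Fintype.card_fin,
      smul_eq_mul] at this
    change _ + Module.finrank ℝ (contrasts m E) = _ at this
    obtain ⟨k, rfl⟩ : ∃ k, m = k + 1 := ⟨m - 1, by omega⟩
    simp only [Nat.add_sub_cancel]
    nlinarith
  · rintro ⟨a, b⟩
    refine ⟨WithLp.toLp 2 (fun o => o.elim a (fun ℓ => if ℓ = ⟨0, hm⟩ then b else 0)), ?_⟩
    simp

/-- The projection is the centred vector `(0, x_ℓ - x̄)`. This exhibits the within sum of squares as
the squared norm of a projection, hence as chi-squared. -/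
lemma norm_sq_projection_contrasts (hm : 0 < m) (x : Stack m E) :
    ‖(contrasts m E).orthogonalProjectionOnto x‖ ^ 2 = ∑ ℓ, ‖x (some ℓ) - stackMean m E x‖ ^ 2 := by
  have hm' : (m : ℝ) ≠ 0 := by positivity
  set v : Stack m E := WithLp.toLp 2 (fun o => o.elim 0 (fun ℓ => x (some ℓ) - stackMean m E x))
    with hv
  have hsum : ∑ ℓ, x (some ℓ) = (m : ℝ) • stackMean m E x := by
    rw [stackMean_apply, smul_smul, mul_inv_cancel₀ hm', one_smul]
  have h1 : v ∈ contrasts m E := by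
    rw [mem_contrasts]
    simp [hv, hsum, Nat.cast_smul_eq_nsmul]
  have h2 : (contrasts m E).starProjection x = v := by
    refine Submodule.eq_starProjection_of_mem_of_inner_eq_zero h1 fun w hw => ?_
    rw [mem_contrasts] at hw
    rw [PiLp.inner_apply, Fintype.sum_option]
    simp [hv, hw.1, ← inner_sum, hw.2]
  rw [← Submodule.norm_coe, ← Submodule.starProjection_apply, h2, PiLp.norm_sq_eq_of_L2,
    Fintype.sum_option]
  simp [hv]

/-- The joint law of the between-component and within-component quadratic forms. -/
lemma stdGaussian_map_quadratic_forms (hm : 0 < m) {r : ℝ} (hr : 0 ≤ r) (N : Submodule ℝ E) :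
    (stdGaussian (Stack m E)).map (fun g =>
      ((1 + (1 + 1 / (m : ℝ)) * r)⁻¹ *
        ‖N.orthogonalProjectionOnto (√(1 + r) • g none + √r • stackMean m E g)‖ ^ 2,
        ∑ ℓ, ‖g (some ℓ) - stackMean m E g‖ ^ 2)) =
      (chiSquared (Module.finrank ℝ N)).prod (chiSquared (Module.finrank ℝ E * (m - 1))) := by
  have hm' : (m : ℝ) ≠ 0 := by positivity
  -- The variance of each coordinate of `√(1+r) g₀ + √r ḡ`: `1 + r` from the base and `r/m` from the
  -- mean.
  set c : ℝ := 1 + (1 + 1 / (m : ℝ)) * r with hc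
  have hc0 : 0 < c := by positivity
  rw [← finrank_contrasts hm]
  set T₁ : Stack m E →L[ℝ] N := (√c)⁻¹ • N.orthogonalProjectionOnto.comp
    (√(1 + r) • PiLp.proj (𝕜 := ℝ) 2 (fun _ : Option (Fin m) => E) none + √r • stackMean m E)
    with hT₁
  -- The adjoint of `T₁`.
  set J₁ : N → Stack m E := fun a => WithLp.toLp 2 (fun o => o.elim (((√c)⁻¹ * √(1 + r)) • (a : E))
    (fun _ => ((√c)⁻¹ * √r * (m : ℝ)⁻¹) • (a : E))) with hJ₁
  rw [← stdGaussian_map_norm_sq_prodMk T₁ (contrasts m E).orthogonalProjectionOnto J₁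
    (fun b => (b : Stack m E))]
  · congr 1
    ext g : 2
    · simp only [hT₁, smul_apply, norm_smul, mul_pow]
      rw [norm_inv, inv_pow, Real.norm_eq_abs, sq_abs, Real.sq_sqrt hc0.le]
      simp
    · rw [norm_sq_projection_contrasts hm]
  · intro x a
    rw [hT₁, hJ₁, PiLp.inner_apply, Fintype.sum_option]
    simp only [smul_apply, ContinuousLinearMap.comp_apply,
      add_apply, Option.elim, PiLp.proj_apply]
    rw [real_inner_smul_left, Submodule.inner_orthogonalProjectionOnto_eq_of_mem_right, inner_add_left,
      stackMean_apply]
    simp only [real_inner_smul_left, real_inner_smul_right, sum_inner, ← Finset.mul_sum]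
    ring
  · intro x a
    rw [Submodule.inner_orthogonalProjectionOnto_eq_of_mem_right]
  · intro a b
    have hb := mem_contrasts.1 b.2
    -- `J₁ a` is constant along the further components, while those of a contrast sum to zero and
    -- its base component vanishes.
    have hz : ⟪J₁ a, (b : Stack m E)⟫ = 0 := by
      rw [PiLp.inner_apply, Fintype.sum_option]
      simp [hJ₁, hb.1, real_inner_smul_left, ← Finset.mul_sum, ← inner_sum, hb.2]
    rw [norm_add_sq_real, hz, Submodule.norm_coe]
    have : ‖J₁ a‖ ^ 2 = ‖a‖ ^ 2 := by
      rw [PiLp.norm_sq_eq_of_L2, Fintype.sum_option]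
      simp only [hJ₁, Option.elim, norm_smul, norm_mul, norm_inv, Real.norm_eq_abs, mul_pow,
        inv_pow, sq_abs, Finset.sum_const, Finset.card_univ, Fintype.card_fin, nsmul_eq_mul,
        Submodule.norm_coe]
      rw [Real.sq_sqrt hc0.le, Real.sq_sqrt hr, Real.sq_sqrt (by positivity)]
      field_simp
      rw [hc]
      field_simp
      ring
    rw [this]
    ring

end Gaussian

/-! ### Conditionally independent draws from a kernel -/

section IndependentDraws

variable {α β ι : Type*} [MeasurableSpace α] [MeasurableSpace β] [Fintype ι]

/-- The kernel of independent draws from `κ`, indexed by `ι`. -/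
def piKernel (ι : Type*) [Fintype ι] (κ : Kernel α β) [IsMarkovKernel κ] : Kernel α (ι → β) where
  toFun x := Measure.pi fun _ => κ x
  measurable' := by
    refine Measurable.measure_of_isPiSystem_of_isProbabilityMeasure generateFrom_pi.symm
      isPiSystem_pi ?_
    rintro _ ⟨B, hB, rfl⟩
    simp only [Measure.pi_pi]
    refine Finset.measurable_prod _ fun i _ => κ.measurable_coe (hB i (Set.mem_univ i))

lemma piKernel_apply (κ : Kernel α β) [IsMarkovKernel κ] (x : α) :
    piKernel ι κ x = Measure.pi fun _ => κ x := rfl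

instance (κ : Kernel α β) [IsMarkovKernel κ] : IsMarkovKernel (piKernel ι κ) :=
  ⟨fun x => by rw [piKernel_apply]; infer_instance⟩

/-- A measure on `α × (ι → β)` is determined by its values on rectangles. -/
lemma eq_compProd_piKernel (μ : Measure α) [IsFiniteMeasure μ] (κ : Kernel α β) [IsMarkovKernel κ]
    (ρ : Measure (α × (ι → β)))
    (hρ : ∀ (A : Set α) (B : ι → Set β), MeasurableSet A → (∀ i, MeasurableSet (B i)) →
      ρ (A ×ˢ Set.univ.pi B) = ∫⁻ x in A, ∏ i, κ x (B i) ∂μ) :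
    ρ = μ ⊗ₘ piKernel ι κ := by
  have hrect : ∀ (A : Set α) (B : ι → Set β), MeasurableSet A → (∀ i, MeasurableSet (B i)) →
      (μ ⊗ₘ piKernel ι κ) (A ×ˢ Set.univ.pi B) = ∫⁻ x in A, ∏ i, κ x (B i) ∂μ := by
    intro A B hA hB
    rw [Measure.compProd_apply_prod hA (MeasurableSet.univ_pi hB)]
    simp only [piKernel_apply, Measure.pi_pi]
  have huniv : ρ Set.univ = (μ ⊗ₘ piKernel ι κ) Set.univ := by
    have h1 := hρ Set.univ (fun _ => Set.univ) .univ (fun _ => .univ)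
    have h2 := hrect Set.univ (fun _ => Set.univ) .univ (fun _ => .univ)
    rw [Set.pi_univ, Set.univ_prod_univ] at h1 h2
    rw [h1, h2]
  have : IsFiniteMeasure ρ := ⟨by rw [huniv]; exact measure_lt_top _ _⟩
  refine ext_of_generate_finite _
    (generateFrom_eq_prod (C := {s : Set α | MeasurableSet s})
      (D := Set.pi Set.univ '' Set.univ.pi fun _ : ι => {s : Set β | MeasurableSet s})
      (by simp) generateFrom_pi isCountablySpanning_measurableSet
      (IsCountablySpanning.pi fun _ => isCountablySpanning_measurableSet)).symm
    (IsPiSystem.prod MeasurableSpace.isPiSystem_measurableSet isPiSystem_pi) ?_ huniv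
  rintro _ ⟨A, hA, _, ⟨B, hB, rfl⟩, rfl⟩
  rw [hρ A B hA fun i => hB i (Set.mem_univ i), hrect A B hA fun i => hB i (Set.mem_univ i)]

/-- Conditional independence in integrated form. -/
lemma integral_compProd_piKernel (μ : Measure α) [IsFiniteMeasure μ] (κ : Kernel α β)
    [IsMarkovKernel κ] (g₀ : α → ℂ) (g : ι → α → β → ℂ) (hg₀ : Measurable g₀)
    (hg : ∀ i, Measurable (Function.uncurry (g i))) (hb₀ : ∀ x, ‖g₀ x‖ ≤ 1)
    (hb : ∀ i x y, ‖g i x y‖ ≤ 1) :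
    ∫ z, g₀ z.1 * ∏ i, g i z.1 (z.2 i) ∂(μ ⊗ₘ piKernel ι κ) =
      ∫ x, g₀ x * ∏ i, ∫ y, g i x y ∂(κ x) ∂μ := by
  rw [Measure.integral_compProd]
  · refine integral_congr_ae (ae_of_all _ fun x => ?_)
    simp only [piKernel_apply]
    rw [integral_const_mul, integral_fintype_prod_eq_prod (f := fun i y => g i x y)]
  · refine Integrable.of_bound (C := 1) ?_ (ae_of_all _ fun z => ?_)
    · refine Measurable.aestronglyMeasurable ?_
      refine (hg₀.comp measurable_fst).mul (Finset.measurable_prod _ fun i _ => ?_)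
      exact (hg i).comp (measurable_fst.prodMk ((measurable_pi_apply i).comp measurable_snd))
    · rw [norm_mul, norm_prod]
      exact mul_le_one₀ (hb₀ _) (by positivity)
        (Finset.prod_le_one (fun _ _ => norm_nonneg _) fun i _ => hb i _ _)

end IndependentDraws

/-! ### Negligible perturbations of limits in distribution -/

section ConvergenceInProbability

variable {α : ℕ → Type*} [∀ n, MeasurableSpace (α n)]

/-- Bounded functions that tend to zero in probability have integrals that tend to zero. -/
lemma tendsto_integral_norm_of_tendsto_measure {V : Type*} [NormedAddCommGroup V]
    (μ : ∀ n, Measure (α n))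
    [∀ n, IsProbabilityMeasure (μ n)] (f : ∀ n, α n → V) (C : ℝ)
    (hf : ∀ n, AEStronglyMeasurable (f n) (μ n)) (hb : ∀ n x, ‖f n x‖ ≤ C)
    (h : ∀ ε > 0, Tendsto (fun n => μ n {x | ε ≤ ‖f n x‖}) atTop (𝓝 0)) :
    Tendsto (fun n => ∫ x, ‖f n x‖ ∂(μ n)) atTop (𝓝 0) := by
  have hC : 0 ≤ C ∨ C < 0 := le_or_gt 0 C
  rcases hC with hC | hC
  swap
  · exfalso
    obtain ⟨x⟩ : Nonempty (α 0) := (μ 0).nonempty_of_neZero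
    linarith [hb 0 x, norm_nonneg (f 0 x)]
  rw [Metric.tendsto_atTop]
  intro ε hε
  have h1 := h (ε / 2) (by positivity)
  have h2 : Tendsto (fun n => (μ n).real {x | ε / 2 ≤ ‖f n x‖}) atTop (𝓝 0) := by
    exact (ENNReal.tendsto_toReal ENNReal.zero_ne_top).comp h1
  -- Splitting at the level `ε / 2` bounds the integral by `ε / 2 + C μ{ε / 2 ≤ ‖f‖}`. The divisor
  -- uses `C + 1` because `C` may be zero.
  obtain ⟨N, hN⟩ := (Metric.tendsto_atTop.1 h2) (ε / (2 * (C + 1))) (by positivity)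
  refine ⟨N, fun n hn => ?_⟩
  have h3 := hN n hn
  rw [Real.dist_eq, sub_zero, abs_of_nonneg measureReal_nonneg] at h3
  rw [Real.dist_eq, sub_zero, abs_of_nonneg (integral_nonneg fun _ => norm_nonneg _)]
  have hmeas : NullMeasurableSet {x | ε / 2 ≤ ‖f n x‖} (μ n) :=
    nullMeasurableSet_le aemeasurable_const (hf n).norm.aemeasurable
  have hint : Integrable (fun x => ‖f n x‖) (μ n) :=
    (Integrable.of_bound (hf n) C (ae_of_all _ (hb n))).norm
  have h4 : ∫ x, ‖f n x‖ ∂(μ n) ≤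
      ∫ x, (ε / 2 + {x | ε / 2 ≤ ‖f n x‖}.indicator (fun _ => C) x) ∂(μ n) := by
    refine integral_mono hint ((integrable_const _).add
      ((integrable_const C).indicator₀ hmeas)) fun x => ?_
    by_cases hx : ε / 2 ≤ ‖f n x‖
    · simp only [Set.indicator, Set.mem_ofPred_eq, hx, if_true]
      linarith [hb n x]
    · simp only [Set.indicator, Set.mem_ofPred_eq, hx, if_false]
      linarith
  rw [integral_add (integrable_const _) ((integrable_const C).indicator₀ hmeas),
    integral_indicator₀ hmeas] at h4
  simp only [integral_const, probReal_univ, smul_eq_mul, one_mul, measureReal_restrict_apply_univ] at h4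
  have h5 : (μ n).real {x | ε / 2 ≤ ‖f n x‖} * (2 * (C + 1)) < ε := by
    rwa [lt_div_iff₀ (by positivity)] at h3
  nlinarith [measureReal_nonneg (μ := μ n) (s := {x | ε / 2 ≤ ‖f n x‖})]

/-- A measurable perturbation that tends to zero in probability does not change the limit in
distribution. -/
lemma tendstoInDistribution_of_tendsto_measure_sub
    {V : Type*} [NormedAddCommGroup V] [InnerProductSpace ℝ V] [FiniteDimensional ℝ V]
    [MeasurableSpace V] [BorelSpace V]
    {Ω' : Type*} [MeasurableSpace Ω'] {P' : Measure Ω'} [IsProbabilityMeasure P']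
    {μ : ∀ n, Measure (α n)} [∀ n, IsProbabilityMeasure (μ n)] {X Y : ∀ n, α n → V} {Z : Ω' → V}
    (hX : TendstoInDistribution X atTop Z μ P') (hY : ∀ n, AEMeasurable (Y n) (μ n))
    (h : ∀ ε > 0, Tendsto (fun n => μ n {x | ε ≤ ‖Y n x - X n x‖}) atTop (𝓝 0)) :
    TendstoInDistribution Y atTop Z μ P' where
  forall_aemeasurable := hY
  aemeasurable_limit := hX.aemeasurable_limit
  tendsto := by
    have hXm := hX.forall_aemeasurable
    have hXt := hX.tendsto
    refine ProbabilityMeasure.tendsto_iff_tendsto_charFun.2 fun t => ?_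
    replace hXt := ProbabilityMeasure.tendsto_iff_tendsto_charFun.1 hXt t
    simp only [ProbabilityMeasure.coe_mk, charFun_apply] at hXt ⊢
    have hint : ∀ (W : ∀ n, α n → V) (n : ℕ), AEMeasurable (W n) (μ n) →
        ∫ x, Complex.exp (⟪x, t⟫ * Complex.I) ∂((μ n).map (W n)) =
          ∫ x, Complex.exp (⟪W n x, t⟫ * Complex.I) ∂(μ n) := fun W n hW =>
      integral_map hW (by fun_prop)
    simp_rw [fun n => hint X n (hXm n)] at hXt
    simp_rw [fun n => hint Y n (hY n)]
    set D : ∀ n, α n → ℂ := fun n x => Complex.exp (⟪Y n x, t⟫ * Complex.I) -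
      Complex.exp (⟪X n x, t⟫ * Complex.I) with hD
    have hm : ∀ (W : ∀ n, α n → V) (n : ℕ), AEMeasurable (W n) (μ n) →
        AEStronglyMeasurable (fun x => Complex.exp (⟪W n x, t⟫ * Complex.I)) (μ n) := by
      intro W n hW
      refine AEMeasurable.aestronglyMeasurable ?_
      exact Complex.measurable_exp.comp_aemeasurable
        ((Complex.measurable_ofReal.comp_aemeasurable (hW.inner aemeasurable_const)).mul_const _)
    -- By Lévy's continuity theorem only the difference of characteristic functions matters. Its
    -- integrand is bounded by 2 and, as `|e^{is} - 1| ≤ |s|`, tends to zero in probability.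
    have hle : ∀ n x, ‖D n x‖ ≤ ‖Y n x - X n x‖ * ‖t‖ := by
      intro n x
      have e1 : D n x = Complex.exp (⟪X n x, t⟫ * Complex.I) *
          (Complex.exp (Complex.I * ((⟪Y n x - X n x, t⟫ : ℝ) : ℂ)) - 1) := by
        rw [hD, mul_sub, ← Complex.exp_add, inner_sub_left]
        push_cast
        ring_nf
      rw [e1, norm_mul, Complex.norm_exp_ofReal_mul_I, one_mul]
      exact (Real.norm_exp_I_mul_ofReal_sub_one_le).trans (norm_inner_le_norm _ _)
    have hD0 : Tendsto (fun n => ∫ x, ‖D n x‖ ∂(μ n)) atTop (𝓝 0) := by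
      refine tendsto_integral_norm_of_tendsto_measure μ D 2
        (fun n => (hm Y n (hY n)).sub (hm X n (hXm n))) (fun n x => ?_) fun ε hε => ?_
      · refine (norm_sub_le _ _).trans ?_
        rw [Complex.norm_exp_ofReal_mul_I, Complex.norm_exp_ofReal_mul_I]
        norm_num
      · refine tendsto_of_tendsto_of_tendsto_of_le_of_le tendsto_const_nhds
          (h (ε / (‖t‖ + 1)) (by positivity)) (fun _ => zero_le) fun n => ?_
        refine measure_mono fun x hx => ?_
        simp only [Set.mem_ofPred_eq] at hx ⊢
        rw [div_le_iff₀ (by positivity)]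
        nlinarith [hle n x, norm_nonneg (Y n x - X n x)]
    have hD1 : Tendsto (fun n => ∫ x, D n x ∂(μ n)) atTop (𝓝 0) :=
      squeeze_zero_norm (fun n => norm_integral_le_integral_norm _) hD0
    have := hXt.add hD1
    rw [add_zero] at this
    refine this.congr fun n => ?_
    rw [hD, integral_sub]
    · ring
    · exact Integrable.of_bound (hm Y n (hY n)) 1
        (ae_of_all _ fun x => (Complex.norm_exp_ofReal_mul_I _).le)
    · exact Integrable.of_bound (hm X n (hXm n)) 1
        (ae_of_all _ fun x => (Complex.norm_exp_ofReal_mul_I _).le)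

end ConvergenceInProbability

/-- Factors are exchanged one at a time, all others staying in the unit disc. This carries
convergence of single conditional characteristic functions over to their product. -/
lemma norm_prod_sub_prod_le_sum {ι : Type*} (s : Finset ι) (a b : ι → ℂ)
    (ha : ∀ i, ‖a i‖ ≤ 1) (hb : ∀ i, ‖b i‖ ≤ 1) :
    ‖∏ i ∈ s, a i - ∏ i ∈ s, b i‖ ≤ ∑ i ∈ s, ‖a i - b i‖ := by
  classical
  induction s using Finset.induction_on with
  | empty => simp
  | insert i s hi ih =>
    rw [Finset.prod_insert hi, Finset.prod_insert hi, Finset.sum_insert hi]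
    have h1 : a i * ∏ j ∈ s, a j - b i * ∏ j ∈ s, b j =
        (a i - b i) * ∏ j ∈ s, a j + b i * (∏ j ∈ s, a j - ∏ j ∈ s, b j) := by ring
    rw [h1]
    refine (norm_add_le _ _).trans ?_
    rw [norm_mul, norm_mul]
    have h2 : ‖∏ j ∈ s, a j‖ ≤ 1 := by
      rw [norm_prod]
      exact Finset.prod_le_one (fun _ _ => norm_nonneg _) fun i _ => ha i
    nlinarith [norm_nonneg (a i - b i), norm_nonneg (∏ j ∈ s, a j - ∏ j ∈ s, b j), hb i,
      norm_nonneg (b i)]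

/-! ### Joint limit of a base vector and conditionally independent deviations -/

section Stack

variable {E : Type*} [NormedAddCommGroup E] [InnerProductSpace ℝ E] [FiniteDimensional ℝ E]
  [MeasurableSpace E] [BorelSpace E] {m : ℕ}

/-- The vector with base component `z₀` and further components `z`. -/
def stackMk (z₀ : E) (z : Fin m → E) : Stack m E := WithLp.toLp 2 fun o => o.elim z₀ z

/-- Scaling of the base component by `a` and of the others by `b`. -/
def stackScale (a b : ℝ) (g : Stack m E) : Stack m E :=
  stackMk (a • g none) fun ℓ => b • g (some ℓ)

lemma continuous_stackScale (a b : ℝ) : Continuous (stackScale a b : Stack m E → Stack m E) := by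
  unfold stackScale stackMk
  refine (PiLp.continuous_toLp 2 _).comp (continuous_pi fun o => ?_)
  cases o <;> simp only [Option.elim] <;> fun_prop

lemma measurable_stackMk {Ω : Type*} [MeasurableSpace Ω] {z₀ : Ω → E} {z : Fin m → Ω → E}
    (h₀ : Measurable z₀) (h : ∀ ℓ, Measurable (z ℓ)) :
    Measurable fun ω => stackMk (z₀ ω) fun ℓ => z ℓ ω := by
  unfold stackMk
  refine (WithLp.measurable_toLp 2 _).comp (measurable_pi_lambda _ fun o => ?_)
  cases o
  · exact h₀
  · exact h _

lemma inner_stackMk (z₀ : E) (z : Fin m → E) (t : Stack m E) :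
    ⟪stackMk z₀ z, t⟫ = ⟪z₀, t none⟫ + ∑ ℓ, ⟪z ℓ, t (some ℓ)⟫ := by
  rw [PiLp.inner_apply, Fintype.sum_option]
  rfl

/-- The scaling is self-adjoint, so it moves onto the argument `t`. -/
lemma charFun_stackScale (a b : ℝ) (t : Stack m E) :
    charFun ((stdGaussian (Stack m E)).map (stackScale a b)) t =
      Complex.exp (-(a ^ 2 * ‖t none‖ ^ 2 : ℝ) / 2) *
        ∏ ℓ : Fin m, Complex.exp (-(b ^ 2 * ‖t (some ℓ)‖ ^ 2 : ℝ) / 2) := by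
  rw [charFun_apply, integral_map (continuous_stackScale a b).aemeasurable (by fun_prop)]
  have key : ∀ g : Stack m E, ⟪stackScale a b g, t⟫ = ⟪g, stackScale a b t⟫ := by
    intro g
    rw [real_inner_comm (stackScale a b t) g, stackScale, inner_stackMk, stackScale, inner_stackMk]
    simp only [real_inner_smul_left]
    congr 1
    · rw [real_inner_comm]
    · exact Finset.sum_congr rfl fun ℓ _ => by rw [real_inner_comm]
  simp_rw [key]
  have := charFun_stdGaussian (stackScale a b t)
  rw [charFun_apply] at this
  rw [this, ← Complex.exp_sum, ← Complex.exp_add]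
  congr 1
  have : ‖stackScale a b t‖ ^ 2 = a ^ 2 * ‖t none‖ ^ 2 + ∑ ℓ, b ^ 2 * ‖t (some ℓ)‖ ^ 2 := by
    rw [PiLp.norm_sq_eq_of_L2, Fintype.sum_option]
    simp [stackScale, stackMk, norm_smul, mul_pow]
  rw [← Finset.sum_div, Finset.sum_neg_distrib, ← Complex.ofReal_sum, ← add_div, ← neg_add,
    ← Complex.ofReal_add, ← this]
  push_cast
  rfl

/-- A base vector that is asymptotically normal, stacked with vectors that are conditionally
independent and conditionally asymptotically normal given the base. -/
lemma tendstoInDistribution_stack {α β Ω : ℕ → Type*} [∀ n, MeasurableSpace (α n)]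
    [∀ n, MeasurableSpace (β n)] [∀ n, MeasurableSpace (Ω n)] (P : ∀ n, Measure (Ω n))
    [∀ n, IsProbabilityMeasure (P n)] (μ : ∀ n, Measure (α n)) [∀ n, IsProbabilityMeasure (μ n)]
    (κ : ∀ n, Kernel (α n) (β n)) [∀ n, IsMarkovKernel (κ n)]
    (A : ∀ n, Ω n → α n) (B : ∀ n, Fin m → Ω n → β n) (hA : ∀ n, Measurable (A n))
    (hB : ∀ n ℓ, Measurable (B n ℓ))
    (hlaw : ∀ n, (P n).map (fun ω => (A n ω, fun ℓ => B n ℓ ω)) = μ n ⊗ₘ piKernel (Fin m) (κ n))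
    (z₀ : ∀ n, α n → E) (z : ∀ n, α n × β n → E) (hz₀ : ∀ n, Measurable (z₀ n))
    (hz : ∀ n, Measurable (z n)) (a b : ℝ)
    (h₀ : ∀ t, Tendsto (fun n => ∫ x, Complex.exp (⟪z₀ n x, t⟫ * Complex.I) ∂(μ n)) atTop
      (𝓝 (Complex.exp (-(a ^ 2 * ‖t‖ ^ 2 : ℝ) / 2))))
    (h₁ : ∀ t, ∀ ε > 0, Tendsto (fun n => μ n {x | ε ≤
      ‖∫ y, Complex.exp (⟪z n (x, y), t⟫ * Complex.I) ∂(κ n x) -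
        Complex.exp (-(b ^ 2 * ‖t‖ ^ 2 : ℝ) / 2)‖}) atTop (𝓝 0)) :
    TendstoInDistribution (fun n ω => stackMk (z₀ n (A n ω)) fun ℓ => z n (A n ω, B n ℓ ω)) atTop
      (stackScale a b : Stack m E → Stack m E) P (stdGaussian (Stack m E)) where
  forall_aemeasurable n := (measurable_stackMk ((hz₀ n).comp (hA n))
    fun ℓ => (hz n).comp ((hA n).prodMk (hB n ℓ))).aemeasurable
  aemeasurable_limit := (continuous_stackScale a b).aemeasurable
  tendsto := by
    refine ProbabilityMeasure.tendsto_iff_tendsto_charFun.2 fun t => ?_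
    simp only [ProbabilityMeasure.coe_mk]
    rw [charFun_stackScale]
    set c : Fin m → ℂ := fun ℓ => Complex.exp (-(b ^ 2 * ‖t (some ℓ)‖ ^ 2 : ℝ) / 2) with hc
    set φ : ∀ n, Fin m → α n → ℂ :=
      fun n ℓ x => ∫ y, Complex.exp (⟪z n (x, y), t (some ℓ)⟫ * Complex.I) ∂(κ n x) with hφ
    set g₀ : ∀ n, α n → ℂ := fun n x => Complex.exp (⟪z₀ n x, t none⟫ * Complex.I) with hg₀
    have hmeas₀ : ∀ n, Measurable (g₀ n) := fun n => Complex.measurable_exp.comp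
      ((Complex.measurable_ofReal.comp ((hz₀ n).inner measurable_const)).mul_const _)
    have hmeas : ∀ n ℓ, Measurable fun p : α n × β n =>
        Complex.exp (⟪z n p, t (some ℓ)⟫ * Complex.I) := fun n ℓ => Complex.measurable_exp.comp
      ((Complex.measurable_ofReal.comp ((hz n).inner measurable_const)).mul_const _)
    have hmeasφ : ∀ n ℓ, StronglyMeasurable (φ n ℓ) := fun n ℓ =>
      (hmeas n ℓ).stronglyMeasurable.integral_kernel_prod_right'
    have hc1 : ∀ ℓ, ‖c ℓ‖ ≤ 1 := by
      intro ℓ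
      rw [hc, Complex.norm_exp, Real.exp_le_one_iff]
      norm_cast
      have : 0 ≤ b ^ 2 * ‖t (some ℓ)‖ ^ 2 := by positivity
      linarith
    have hφ1 : ∀ n ℓ x, ‖φ n ℓ x‖ ≤ 1 := by
      intro n ℓ x
      refine (norm_integral_le_integral_norm _).trans ?_
      simp [Complex.norm_exp_ofReal_mul_I]
    -- Conditioning on the base data factorizes the characteristic function of the stack.
    have hchar : ∀ n, charFun ((P n).map fun ω => stackMk (z₀ n (A n ω)) fun ℓ =>
        z n (A n ω, B n ℓ ω)) t = ∫ x, g₀ n x * ∏ ℓ, φ n ℓ x ∂(μ n) := by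
      intro n
      have hAB : Measurable fun ω => (A n ω, fun ℓ => B n ℓ ω) :=
        (hA n).prodMk (measurable_pi_lambda _ fun ℓ => hB n ℓ)
      have hY : Measurable fun ω => stackMk (z₀ n (A n ω)) fun ℓ => z n (A n ω, B n ℓ ω) :=
        measurable_stackMk ((hz₀ n).comp (hA n)) fun ℓ => (hz n).comp ((hA n).prodMk (hB n ℓ))
      rw [charFun_apply, integral_map hY.aemeasurable (by fun_prop)]
      rw [← integral_compProd_piKernel (μ n) (κ n) (g₀ n)
        (fun ℓ x y => Complex.exp (⟪z n (x, y), t (some ℓ)⟫ * Complex.I)) (hmeas₀ n) (hmeas n)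
        (fun x => (Complex.norm_exp_ofReal_mul_I _).le)
        (fun ℓ x y => (Complex.norm_exp_ofReal_mul_I _).le), ← hlaw n,
        integral_map hAB.aemeasurable]
      · refine integral_congr_ae (ae_of_all _ fun ω => ?_)
        simp only [hg₀, inner_stackMk]
        rw [← Complex.exp_sum, ← Complex.exp_add, ← Finset.sum_mul]
        push_cast
        ring_nf
      · refine Measurable.aestronglyMeasurable ?_
        refine ((hmeas₀ n).comp measurable_fst).mul (Finset.measurable_prod _ fun ℓ _ => ?_)
        exact (hmeas n ℓ).comp
          (measurable_fst.prodMk ((measurable_pi_apply ℓ).comp measurable_snd))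
    simp_rw [hchar]
    have hdiff : ∀ ℓ, Tendsto (fun n => ∫ x, ‖φ n ℓ x - c ℓ‖ ∂(μ n)) atTop (𝓝 0) := by
      intro ℓ
      refine tendsto_integral_norm_of_tendsto_measure μ _ 2
        (fun n => ((hmeasφ n ℓ).sub stronglyMeasurable_const).aestronglyMeasurable)
        (fun n x => (norm_sub_le _ _).trans ?_) (h₁ (t (some ℓ)))
      linarith [hφ1 n ℓ x, hc1 ℓ]
    have hdiff' : Tendsto (fun n => ∑ ℓ, ∫ x, ‖φ n ℓ x - c ℓ‖ ∂(μ n)) atTop (𝓝 0) := by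
      simpa using tendsto_finsetSum Finset.univ fun ℓ _ => hdiff ℓ
    have hprodm : ∀ n, AEStronglyMeasurable (fun x => g₀ n x * ∏ ℓ, φ n ℓ x) (μ n) := fun n =>
      ((hmeas₀ n).stronglyMeasurable.mul
        (Finset.stronglyMeasurable_fun_prod _ fun ℓ _ => hmeasφ n ℓ)).aestronglyMeasurable
    have hg₀1 : ∀ n x, ‖g₀ n x‖ = 1 := fun n x => Complex.norm_exp_ofReal_mul_I _
    have hint1 : ∀ n, Integrable (fun x => g₀ n x * ∏ ℓ, φ n ℓ x) (μ n) := fun n =>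
      Integrable.of_bound (hprodm n) 1 (ae_of_all _ fun x => by
        rw [norm_mul, hg₀1, one_mul, norm_prod]
        exact Finset.prod_le_one (fun _ _ => norm_nonneg _) fun i _ => hφ1 n i x)
    have hint2 : ∀ n, Integrable (fun x => g₀ n x * ∏ ℓ, c ℓ) (μ n) := fun n =>
      (Integrable.of_bound (hmeas₀ n).aestronglyMeasurable 1
        (ae_of_all _ fun x => (hg₀1 n x).le)).mul_const _
    -- The random factors `φ` may be replaced by their constant limits: all factors are bounded by
    -- 1, so convergence in probability is enough. What remains is the characteristic function of
    -- the base times a constant.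
    have hlim : Tendsto (fun n => ∫ x, g₀ n x * ∏ ℓ, φ n ℓ x ∂(μ n) -
        ∫ x, g₀ n x * ∏ ℓ, c ℓ ∂(μ n)) atTop (𝓝 0) := by
      refine squeeze_zero_norm (fun n => ?_) hdiff'
      have hi : ∀ ℓ, Integrable (fun x => ‖φ n ℓ x - c ℓ‖) (μ n) := fun ℓ =>
        ((Integrable.of_bound (hmeasφ n ℓ).aestronglyMeasurable 1
          (ae_of_all _ fun x => hφ1 n ℓ x)).sub (integrable_const _)).norm
      rw [← integral_sub (hint1 n) (hint2 n), ← integral_finsetSum _ fun ℓ _ => hi ℓ]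
      refine (norm_integral_le_integral_norm _).trans
        (integral_mono ((hint1 n).sub (hint2 n)).norm
          (integrable_finsetSum _ fun ℓ _ => hi ℓ) fun x => ?_)
      simp only [← mul_sub, norm_mul, hg₀1, one_mul]
      exact norm_prod_sub_prod_le_sum _ _ _ (fun ℓ => hφ1 n ℓ x) hc1
    have hlim2 := (h₀ (t none)).mul_const (∏ ℓ, c ℓ)
    have := hlim.add hlim2
    rw [zero_add] at this
    refine this.congr fun n => ?_
    rw [integral_mul_const]
    ring

end Stack

/-! ### Whitening of a positive definite matrix -/

section Whitening

/-- A linear change of coordinates that turns the quadratic form of a positive definite matrix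
into the Euclidean one. -/
lemma exists_whitening {h : ℕ} {M : Matrix (Fin h) (Fin h) ℝ} (hM : M.PosDef) :
    ∃ (S : EuclideanSpace ℝ (Fin h) ≃L[ℝ] EuclideanSpace ℝ (Fin h))
      (S' : EuclideanSpace ℝ (Fin h) → EuclideanSpace ℝ (Fin h)),
      (∀ v, ‖S v‖ ^ 2 = v.ofLp ⬝ᵥ M.mulVec v.ofLp) ∧
      (∀ v t, ⟪S v, t⟫ = ⟪v, S' t⟫) ∧
      ∀ t, (S' t).ofLp ⬝ᵥ M⁻¹.mulVec (S' t).ofLp = ‖t‖ ^ 2 := by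
  have hsq : CFC.sqrt M * CFC.sqrt M = M := CFC.sqrt_mul_sqrt_self _ hM.posSemidef.nonneg
  have hsa : IsSelfAdjoint (Matrix.toEuclideanCLM (𝕜 := ℝ) (CFC.sqrt M)) :=
    (CFC.sqrt_nonneg M).isSelfAdjoint.map _
  set B := CFC.sqrt M with hB
  have hunit : IsUnit B := by
    have : IsUnit (B * B) := hsq ▸ hM.isUnit
    exact isUnit_of_mul_isUnit_left this
  have hdet : IsUnit B.det := (Matrix.isUnit_iff_isUnit_det B).1 hunit
  have hsymm : ∀ v t, ⟪Matrix.toEuclideanCLM (𝕜 := ℝ) B v, t⟫ =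
      ⟪v, Matrix.toEuclideanCLM (𝕜 := ℝ) B t⟫ := fun v t => by
    rw [← ContinuousLinearMap.adjoint_inner_left, hsa.adjoint_eq]
  -- Both maps are `B = √M`, which is its own adjoint; the last property is `B M⁻¹ B = 1`.
  refine ⟨ContinuousLinearEquiv.equivOfInverse (Matrix.toEuclideanCLM (𝕜 := ℝ) B)
    (Matrix.toEuclideanCLM (𝕜 := ℝ) B⁻¹) (fun v => ?_) (fun v => ?_),
    Matrix.toEuclideanCLM (𝕜 := ℝ) B, fun v => ?_, hsymm, fun t => ?_⟩
  · rw [← mul_apply_eq_comp, ← map_mul, Matrix.nonsing_inv_mul _ hdet, map_one]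
    rfl
  · rw [← mul_apply_eq_comp, ← map_mul, Matrix.mul_nonsing_inv _ hdet, map_one]
    rfl
  · rw [← real_inner_self_eq_norm_sq]
    change ⟪Matrix.toEuclideanCLM (𝕜 := ℝ) B v, Matrix.toEuclideanCLM (𝕜 := ℝ) B v⟫ = _
    rw [hsymm, ← mul_apply_eq_comp, ← map_mul, hsq, Matrix.inner_toEuclideanCLM]
  · rw [← Matrix.inner_toEuclideanCLM, hsymm, ← mul_apply_eq_comp,
      ← mul_apply_eq_comp, ← map_mul, ← map_mul, ← hsq, Matrix.mul_inv_rev,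
      Matrix.mul_nonsing_inv_cancel_left _ _ hdet, Matrix.nonsing_inv_mul _ hdet, map_one,
      one_apply_eq_self, real_inner_self_eq_norm_sq]

end Whitening

/-! ### Quadratic approximation at a critical point -/

section Taylor

variable {E : Type*} [NormedAddCommGroup E] [NormedSpace ℝ E]

/-- Second-order Taylor formula at a critical point, with Lagrange remainder. -/
lemma exists_taylor_of_fderiv_eq_zero {L : E → ℝ} {B : Set E} (hB : IsOpen B) (hconv : Convex ℝ B)
    (hL : ContDiffOn ℝ 2 L B) {p ψ : E} (hp : p ∈ B) (hψ : ψ ∈ B) (hcrit : fderiv ℝ L p = 0) :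
    ∃ ξ ∈ B, 2 * (L ψ - L p) = fderiv ℝ (fderiv ℝ L) ξ (ψ - p) (ψ - p) := by
  set v := ψ - p with hv
  have hmem : ∀ t ∈ Set.Icc (0 : ℝ) 1, p + t • v ∈ B := fun t ht =>
    hconv.add_smul_sub_mem hp hψ ht
  have hd1 : ∀ t ∈ Set.Icc (0 : ℝ) 1, HasDerivAt (fun t : ℝ => L (p + t • v))
      (fderiv ℝ L (p + t • v) v) t := by
    intro t ht
    have h1 : HasFDerivAt L (fderiv ℝ L (p + t • v)) (p + t • v) :=
      ((hL.contDiffAt (hB.mem_nhds (hmem t ht))).differentiableAt (by norm_num)).hasFDerivAt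
    have h2 : HasDerivAt (fun t : ℝ => p + t • v) v t := by
      simpa using ((hasDerivAt_id t).smul_const v).const_add p
    exact h1.comp_hasDerivAt t h2
  have hd2 : ∀ t ∈ Set.Icc (0 : ℝ) 1, HasDerivAt (fun t : ℝ => fderiv ℝ L (p + t • v) v)
      (fderiv ℝ (fderiv ℝ L) (p + t • v) v v) t := by
    intro t ht
    have h0 : ContDiffAt ℝ 1 (fderiv ℝ L) (p + t • v) :=
      (hL.contDiffAt (hB.mem_nhds (hmem t ht))).fderiv_right (by norm_num)
    have h1 := (h0.differentiableAt (by norm_num)).hasFDerivAt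
    have h2 : HasDerivAt (fun t : ℝ => p + t • v) v t := by
      simpa using ((hasDerivAt_id t).smul_const v).const_add p
    have h3 := h1.comp_hasDerivAt t h2
    simpa using h3.clm_apply (hasDerivAt_const t v)
  set c := L ψ - L p with hc
  -- The coefficient `c` is chosen so that `F 0 = F 1`. Rolle gives a zero `t₁` of `F'`; since `F' 0
  -- = 0` by criticality, Rolle on `[0, t₁]` gives a zero of `F''`, which is the formula.
  set F : ℝ → ℝ := fun t => L (p + t • v) - c * t ^ 2 with hF
  set F' : ℝ → ℝ := fun t => fderiv ℝ L (p + t • v) v - c * (2 * t) with hF'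
  set F'' : ℝ → ℝ := fun t => fderiv ℝ (fderiv ℝ L) (p + t • v) v v - c * 2 with hF''
  have hFd : ∀ t ∈ Set.Icc (0 : ℝ) 1, HasDerivAt F (F' t) t := fun t ht => by
    have := (hd1 t ht).fun_sub (((hasDerivAt_id t).pow 2).const_mul c)
    simpa [hF, hF', mul_comm, mul_left_comm] using this
  have hFd' : ∀ t ∈ Set.Icc (0 : ℝ) 1, HasDerivAt F' (F'' t) t := fun t ht => by
    have := (hd2 t ht).fun_sub (((hasDerivAt_id t).const_mul 2).const_mul c)
    simpa [hF', hF''] using this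
  obtain ⟨t₁, ht₁, h₁⟩ := exists_hasDerivAt_eq_zero (f := F) (f' := F') zero_lt_one
    (fun t ht => (hFd t ht).continuousAt.continuousWithinAt) (by simp [hF, hc, hv])
    (fun t ht => hFd t (Set.Ioo_subset_Icc_self ht))
  have hsub : Set.Icc 0 t₁ ⊆ Set.Icc (0 : ℝ) 1 := Set.Icc_subset_Icc_right ht₁.2.le
  obtain ⟨t₂, ht₂, h₂⟩ := exists_hasDerivAt_eq_zero (f := F') (f' := F'') ht₁.1
    (fun t ht => (hFd' t (hsub ht)).continuousAt.continuousWithinAt) (by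
      rw [h₁]
      simp [hF', hcrit])
    (fun t ht => hFd' t (hsub (Set.Ioo_subset_Icc_self ht)))
  refine ⟨p + t₂ • v, hmem t₂ (hsub (Set.Ioo_subset_Icc_self ht₂)), ?_⟩
  simp only [hF''] at h₂
  linarith

/-- A function whose second derivative is close to `-q` is close to a quadratic near its critical
point. -/
lemma abs_two_mul_sub_sub_le {L : E → ℝ} {B : Set E} (hB : IsOpen B) (hconv : Convex ℝ B)
    (hL : ContDiffOn ℝ 2 L B) {p ψ : E} (hp : p ∈ B) (hψ : ψ ∈ B) (hcrit : fderiv ℝ L p = 0)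
    {q : E → ℝ} {ρ : ℝ}
    (hq : ∀ ξ ∈ B, ∀ v, |fderiv ℝ (fderiv ℝ L) ξ v v + q v| ≤ ρ * q v) :
    |2 * (L p - L ψ) - q (ψ - p)| ≤ ρ * q (ψ - p) := by
  obtain ⟨ξ, hξ, h⟩ := exists_taylor_of_fderiv_eq_zero hB hconv hL hp hψ hcrit
  have := hq ξ hξ (ψ - p)
  rw [← h] at this
  rw [abs_le] at this ⊢
  constructor <;> linarith [this.1, this.2]

end Taylor

/-! ### Level sets compared with their tangent spaces -/

section Constraint

variable {E F : Type*} [NormedAddCommGroup E] [NormedSpace ℝ E] [FiniteDimensional ℝ E]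
  [NormedAddCommGroup F] [NormedSpace ℝ F] [FiniteDimensional ℝ F]

/-- Points of a level set are close to the tangent space. -/
lemma exists_ker_near_of_level {G : E → F} {A : E →L[ℝ] F} {x₀ : E} (hG : HasStrictFDerivAt G A x₀)
    (hA : Function.Surjective A) {ρ : ℝ} (hρ : 0 < ρ) :
    ∃ δ > 0, ∀ x, ‖x‖ < δ → G (x₀ + x) = G x₀ → ∃ w ∈ A.ker, ‖x - w‖ ≤ ρ * ‖x‖ := by
  obtain ⟨R, hR⟩ := A.exists_rightInverse_of_surjective (LinearMap.range_eq_top.2 hA)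
  have h1 := hG.hasFDerivAt.isLittleO
  have h2 := h1.def (c := ρ / (‖R‖ + 1)) (by positivity)
  obtain ⟨δ, hδ, h⟩ := Metric.eventually_nhds_iff.1 h2
  -- The right inverse `R` corrects `x` into the kernel. The correction is small because `G (x₀ + x)
  -- = G x₀` forces `A x = o(x)`.
  refine ⟨δ, hδ, fun x hx hGx => ⟨x - R (A x), ?_, ?_⟩⟩
  · have : A (R (A x)) = A x := congrArg (fun f => f (A x)) hR
    simp [this]
  · have h3 := h (y := x₀ + x) (by simpa [dist_eq_norm] using hx)
    rw [hGx] at h3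
    simp only [sub_self, add_sub_cancel_left, zero_sub, norm_neg] at h3
    rw [sub_sub_cancel]
    calc ‖R (A x)‖ ≤ ‖R‖ * ‖A x‖ := R.le_opNorm _
      _ ≤ (‖R‖ + 1) * (ρ / (‖R‖ + 1) * ‖x‖) := by gcongr; linarith
      _ = ρ * ‖x‖ := by field_simp

/-- Tangent vectors are close to points of the level set. -/
lemma exists_level_near_of_ker {G : E → F} {A : E →L[ℝ] F} {x₀ : E} (hG : HasStrictFDerivAt G A x₀)
    (hA : Function.Surjective A) {ρ : ℝ} (hρ : 0 < ρ) :
    ∃ δ > 0, ∀ w ∈ A.ker, ‖w‖ < δ → ∃ x, G (x₀ + x) = G x₀ ∧ ‖x - w‖ ≤ ρ * ‖w‖ := by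
  have hA' : A.range = ⊤ := LinearMap.range_eq_top.2 hA
  -- The implicit function parametrizes the level set by the kernel, and its derivative at `0` is
  -- the inclusion.
  have h1 := (hG.to_implicitFunction hA').hasFDerivAt.isLittleO.def hρ
  have h2 : ∀ᶠ w : A.ker in 𝓝 0, G (hG.implicitFunction G A hA' (G x₀) w) = G x₀ :=
    (Continuous.prodMk_right (G x₀)).tendsto (0 : A.ker) (hG.map_implicitFunction_eq hA')
  have h3 : hG.implicitFunction G A hA' (G x₀) 0 = x₀ := by
    simp
  obtain ⟨δ, hδ, h⟩ := Metric.eventually_nhds_iff.1 (h1.and h2)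
  refine ⟨δ, hδ, fun w hw hwδ => ⟨hG.implicitFunction G A hA' (G x₀) ⟨w, hw⟩ - x₀, ?_, ?_⟩⟩
  · rw [add_sub_cancel]
    exact (h (y := ⟨w, hw⟩) (by simpa [dist_eq_norm] using hwδ)).2
  · have := (h (y := ⟨w, hw⟩) (by simpa [dist_eq_norm] using hwδ)).1
    rw [h3] at this
    simpa using this

end Constraint

/-! ### Minimal values of a nearly quadratic function, free and constrained -/

section Minimization

variable {E : Type*} [NormedAddCommGroup E] [InnerProductSpace ℝ E] {m : ℕ}

/-- The mean of finitely many vectors. -/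
def mean (a : Fin m → E) : E := (m : ℝ)⁻¹ • ∑ ℓ, a ℓ

/-- The mean squared distance to the mean. -/
def spread (a : Fin m → E) : ℝ := (m : ℝ)⁻¹ * ∑ ℓ, ‖a ℓ - mean a‖ ^ 2

lemma spread_nonneg (a : Fin m → E) : 0 ≤ spread a := by
  unfold spread
  positivity

/-- The cross term vanishes because the deviations `a ℓ - mean a` sum to zero. Thus an average of
paraboloids with different centres is one paraboloid centred at the mean. -/
lemma mean_norm_sq_sub (hm : 0 < m) (a : Fin m → E) (x : E) :
    (m : ℝ)⁻¹ * ∑ ℓ, ‖x - a ℓ‖ ^ 2 = spread a + ‖x - mean a‖ ^ 2 := by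
  have hm' : (m : ℝ) ≠ 0 := by positivity
  have hsum : ∑ ℓ, (a ℓ - mean a) = 0 := by
    rw [Finset.sum_sub_distrib, mean]
    simp only [Finset.sum_const, Finset.card_univ, Fintype.card_fin]
    rw [← Nat.cast_smul_eq_nsmul ℝ, smul_smul, mul_inv_cancel₀ hm', one_smul, sub_self]
  have h : ∀ ℓ, ‖x - a ℓ‖ ^ 2 =
      ‖x - mean a‖ ^ 2 - 2 * ⟪x - mean a, a ℓ - mean a⟫ + ‖a ℓ - mean a‖ ^ 2 := by
    intro ℓ
    rw [← norm_sub_sq_real, sub_sub_sub_cancel_right]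
  simp_rw [h]
  rw [Finset.sum_add_distrib, Finset.sum_sub_distrib, ← Finset.mul_sum, ← inner_sum, hsum,
    inner_zero_right, spread]
  simp only [Finset.sum_const, Finset.card_univ, Fintype.card_fin, nsmul_eq_mul]
  field_simp
  ring

lemma norm_mean_le (hm : 0 < m) {a : Fin m → E} {K : ℝ} (ha : ∀ ℓ, ‖a ℓ‖ ≤ K) : ‖mean a‖ ≤ K := by
  have hm' : (m : ℝ) ≠ 0 := by positivity
  rw [mean, norm_smul, norm_inv, Real.norm_natCast]
  calc (m : ℝ)⁻¹ * ‖∑ ℓ, a ℓ‖ ≤ (m : ℝ)⁻¹ * ∑ _ℓ : Fin m, K := by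
        gcongr
        exact norm_sum_le_of_le _ fun ℓ _ => ha ℓ
    _ = K := by simp [hm']

lemma spread_le (hm : 0 < m) {a : Fin m → E} {K : ℝ} (ha : ∀ ℓ, ‖a ℓ‖ ≤ K) : spread a ≤ K ^ 2 := by
  have hm' : (m : ℝ) ≠ 0 := by positivity
  have h := mean_norm_sq_sub hm a 0
  have h1 : (m : ℝ)⁻¹ * ∑ ℓ, ‖0 - a ℓ‖ ^ 2 ≤ (m : ℝ)⁻¹ * ∑ _ℓ : Fin m, K ^ 2 := by
    gcongr with ℓ
    simpa using ha ℓ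
  rw [h] at h1
  have h2 : (m : ℝ)⁻¹ * ∑ _ℓ : Fin m, K ^ 2 = K ^ 2 := by simp [hm']
  nlinarith [sq_nonneg ‖0 - mean a‖]

variable {T : Type*} {Λ : T → ℝ} {x : T → E} {U : Set T} {a : Fin m → E} {ρ K : ℝ}

/-- The minimal value of a function that is close to a mean of squared distances. -/
lemma abs_min_sub_spread_le (hρ' : ρ ≤ 1 / 2)
    (hΛ : ∀ ψ ∈ U, |Λ ψ - (spread a + ‖x ψ - mean a‖ ^ 2)| ≤ ρ * (spread a + ‖x ψ - mean a‖ ^ 2))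
    {p p' : T} (hp : p ∈ U) (hp' : p' ∈ U) (hx : x p' = mean a) (hle : Λ p ≤ Λ p') :
    |Λ p - spread a| ≤ ρ * spread a := by
  have h1 := abs_le.1 (hΛ p hp)
  have h2 := abs_le.1 (hΛ p' hp')
  rw [hx, sub_self, norm_zero] at h2
  rw [abs_le]
  have := sq_nonneg ‖x p - mean a‖
  constructor
  · nlinarith [h1.1]
  · nlinarith [h2.2]

/-- The arithmetic of the constrained minimum: `V` is the minimal value, `Q` the spread, `u` and `d`
the distances of the minimizer and of `N` from the mean, and `v`, `β` the squared distances of two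
competitors. The crude competitor `β` yields `u ≤ 3K`. Then `d ≤ u + 4ρK` bounds `V` from below, and
the good competitor `v` bounds it from above. The lower bound is the costlier one: `41 = 1 + 8 + 24
+ 8`, the terms coming from `ρQ`, `ρu²`, `8ρKu` and `16(ρK)²`. -/
lemma abs_sub_sub_le_of_bounds {Q u d v β V : ℝ} (hρ : 0 ≤ ρ) (hρ' : ρ ≤ 1 / 2) (hK : 0 ≤ K)
    (hu : 0 ≤ u) (hd : 0 ≤ d) (hdK : d ≤ K) (hQ : 0 ≤ Q) (hQK : Q ≤ K ^ 2) (hβ : β ≤ K ^ 2)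
    (h1 : -(ρ * (Q + u ^ 2)) ≤ V - (Q + u ^ 2)) (h2 : V - (Q + v) ≤ ρ * (Q + v))
    (hv : v ≤ (d + ρ * K) ^ 2) (h3 : V - (Q + β) ≤ ρ * (Q + β)) (h6 : d ≤ u + ρ * (K + u)) :
    |V - Q - d ^ 2| ≤ 41 * ρ * K ^ 2 := by
  have hρK : 0 ≤ ρ * K := mul_nonneg hρ hK
  have hρK2 : 0 ≤ ρ * K ^ 2 := by positivity
  have hu2 : ρ * u ^ 2 ≤ 1 / 2 * u ^ 2 := mul_le_mul_of_nonneg_right hρ' (sq_nonneg u)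
  have hQ2 : ρ * Q ≤ ρ * K ^ 2 := mul_le_mul_of_nonneg_left hQK hρ
  have hβ2 : ρ * β ≤ ρ * K ^ 2 := mul_le_mul_of_nonneg_left hβ hρ
  have hρK3 : ρ * K ^ 2 ≤ 1 / 2 * K ^ 2 := mul_le_mul_of_nonneg_right hρ' (sq_nonneg K)
  have h7 : u ^ 2 ≤ 8 * K ^ 2 := by linarith
  have h8 : u ≤ 3 * K := by
    by_contra h
    push Not at h
    nlinarith
  have hu3 : ρ * u ≤ ρ * (3 * K) := mul_le_mul_of_nonneg_left h8 hρ
  have h9 : d ≤ u + 4 * (ρ * K) := by linarith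
  have h10 : d ^ 2 ≤ (u + 4 * (ρ * K)) ^ 2 := pow_le_pow_left₀ hd h9 2
  have h11 : (ρ * K) * u ≤ (ρ * K) * (3 * K) := mul_le_mul_of_nonneg_left h8 hρK
  have h12 : (ρ * K) ^ 2 ≤ 1 / 2 * (ρ * K ^ 2) := by
    have := mul_le_mul_of_nonneg_right hρ' hρK2
    linarith [show (ρ * K) ^ 2 = ρ * (ρ * K ^ 2) by ring]
  have h13 : ρ * u ^ 2 ≤ ρ * (8 * K ^ 2) := mul_le_mul_of_nonneg_left h7 hρ
  have h15 : (ρ * K) * d ≤ (ρ * K) * K := mul_le_mul_of_nonneg_left hdK hρK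
  have h16 : ρ * v ≤ ρ * (4 * K ^ 2) := by
    refine mul_le_mul_of_nonneg_left (hv.trans ?_) hρ
    have h : d + ρ * K ≤ 2 * K := by
      have := mul_le_mul_of_nonneg_right hρ' hK
      linarith
    have := pow_le_pow_left₀ (add_nonneg hd hρK) h 2
    linarith [show (2 * K) ^ 2 = 4 * K ^ 2 by ring]
  rw [abs_le]
  constructor
  · linarith [show (u + 4 * (ρ * K)) ^ 2 = u ^ 2 + 8 * ((ρ * K) * u) + 16 * (ρ * K) ^ 2 by ring,
      show (ρ * K) * (3 * K) = 3 * (ρ * K ^ 2) by ring]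
  · linarith [show (d + ρ * K) ^ 2 = d ^ 2 + 2 * ((ρ * K) * d) + (ρ * K) ^ 2 by ring,
      show (ρ * K) * K = ρ * K ^ 2 by ring]

/-- The constrained minimal value of a function that is close to a mean of squared distances, when
the constraint set is close to a linear subspace. -/
lemma abs_constrained_min_sub_le (N : Submodule ℝ E) [N.HasOrthogonalProjection]
    (hρ : 0 ≤ ρ) (hρ' : ρ ≤ 1 / 2)
    (hΛ : ∀ ψ ∈ U, |Λ ψ - (spread a + ‖x ψ - mean a‖ ^ 2)| ≤ ρ * (spread a + ‖x ψ - mean a‖ ^ 2))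
    (hK : ‖mean a‖ ≤ K) (hK' : spread a ≤ K ^ 2)
    {p p₁ p₂ : T} (hp : p ∈ U) (hp₁ : p₁ ∈ U) (hp₂ : p₂ ∈ U) (hle₁ : Λ p ≤ Λ p₁)
    (hle₂ : Λ p ≤ Λ p₂) (hx₁ : ‖x p₁ - N.starProjection (mean a)‖ ≤ ρ * K)
    (hx₂ : x p₂ = 0) (hx : ∃ w ∈ N, ‖x p - w‖ ≤ ρ * ‖x p‖) :
    |Λ p - spread a - ‖mean a - N.starProjection (mean a)‖ ^ 2| ≤ 41 * ρ * K ^ 2 := by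
  have hK0 : 0 ≤ K := (norm_nonneg _).trans hK
  obtain ⟨w, hw, hxw⟩ := hx
  set b := mean a with hb
  set d := ‖b - N.starProjection b‖ with hd
  set u := ‖x p - b‖ with hu
  have hd0 : 0 ≤ d := norm_nonneg _
  have hu0 : 0 ≤ u := norm_nonneg _
  have hs0 := spread_nonneg a
  -- Applied below to the point of `N` close to `x p`, this keeps the constrained minimizer from
  -- being much nearer to the mean than `N` is.
  have hmin : ∀ w ∈ N, d ≤ ‖b - w‖ := by
    intro w hw
    rw [hd, N.starProjection_minimal]
    exact ciInf_le ⟨0, by rintro _ ⟨y, rfl⟩; exact norm_nonneg _⟩ (⟨w, hw⟩ : N)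
  have hdK : d ≤ K := by
    have := hmin 0 N.zero_mem
    rw [sub_zero] at this
    exact this.trans hK
  have h1 := (abs_le.1 (hΛ p hp)).1
  have h2 := (abs_le.1 (hΛ p₁ hp₁)).2
  have h3 := (abs_le.1 (hΛ p₂ hp₂)).2
  rw [hx₂, zero_sub, norm_neg] at h3
  have h4 : ‖x p₁ - b‖ ≤ d + ρ * K := by
    have : x p₁ - b = (x p₁ - N.starProjection b) - (b - N.starProjection b) := by abel
    rw [this]
    refine (norm_sub_le _ _).trans ?_
    linarith
  have h4' : ‖x p₁ - b‖ ^ 2 ≤ (d + ρ * K) ^ 2 := by gcongr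
  have h5 : ‖x p‖ ≤ K + u := by
    have : x p = b + (x p - b) := by abel
    rw [this]
    refine (norm_add_le _ _).trans ?_
    have : ‖b + (x p - b) - b‖ = u := by rw [hu]; congr 1; abel
    linarith
  have h6 : d ≤ u + ρ * (K + u) := by
    refine (hmin w hw).trans ?_
    have : b - w = (x p - w) - (x p - b) := by abel
    rw [this]
    refine (norm_sub_le _ _).trans ?_
    have : ρ * ‖x p‖ ≤ ρ * (K + u) := by gcongr
    linarith
  have hbK : ‖b‖ ^ 2 ≤ K ^ 2 := by gcongr
  exact abs_sub_sub_le_of_bounds hρ hρ' hK0 hu0 hd0 hdK hs0 hK' hbK h1 (by linarith [h2, hle₁]) h4'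
    (by linarith [h3, hle₂]) h6

end Minimization

/-! ### From entrywise to relative closeness of Hessians -/

section Hessian

variable {h : ℕ}

lemma bilinear_apply_self (D : EuclideanSpace ℝ (Fin h) →L[ℝ] EuclideanSpace ℝ (Fin h) →L[ℝ] ℝ)
    (v : EuclideanSpace ℝ (Fin h)) :
    D v v = ∑ i, ∑ j, v i * v j * D (EuclideanSpace.single i 1) (EuclideanSpace.single j 1) := by
  have hv : v = ∑ i, v i • EuclideanSpace.single i (1 : ℝ) := by
    conv_lhs => rw [← (EuclideanSpace.basisFun (Fin h) ℝ).sum_repr v]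
    simp
  conv_lhs => rw [hv]
  simp only [map_sum, sum_apply, map_smul, smul_apply, smul_eq_mul]
  rw [Finset.sum_comm]
  exact Finset.sum_congr rfl fun i _ => by
    rw [Finset.mul_sum]
    exact Finset.sum_congr rfl fun j _ => by ring

/-- Entrywise closeness of a normalized Hessian to `-M` in terms of quadratic forms. -/
lemma abs_hessian_add_le {M J : Matrix (Fin h) (Fin h) ℝ}
    (S : EuclideanSpace ℝ (Fin h) ≃L[ℝ] EuclideanSpace ℝ (Fin h))
    (hS : ∀ v, ‖S v‖ ^ 2 = v.ofLp ⬝ᵥ M.mulVec v.ofLp)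
    (D : EuclideanSpace ℝ (Fin h) →L[ℝ] EuclideanSpace ℝ (Fin h) →L[ℝ] ℝ) {c τ : ℝ} (hc : 0 < c)
    (hτ : 0 ≤ τ)
    (hJ : ∀ i j, J i j = -(c⁻¹ * D (EuclideanSpace.single i 1) (EuclideanSpace.single j 1)))
    (hJM : ∀ i j, |J i j - M i j| ≤ τ) (v : EuclideanSpace ℝ (Fin h)) :
    |D v v + c * ‖S v‖ ^ 2| ≤
      (h : ℝ) ^ 2 * ‖(S.symm : EuclideanSpace ℝ (Fin h) →L[ℝ] EuclideanSpace ℝ (Fin h))‖ ^ 2 * τ *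
        (c * ‖S v‖ ^ 2) := by
  have h1 : D v v + c * ‖S v‖ ^ 2 = c * ∑ i, ∑ j, v i * v j * (M i j - J i j) := by
    rw [bilinear_apply_self, hS, dotProduct, Finset.mul_sum, Finset.mul_sum,
      ← Finset.sum_add_distrib]
    refine Finset.sum_congr rfl fun i _ => ?_
    rw [Matrix.mulVec, dotProduct, Finset.mul_sum, Finset.mul_sum, Finset.mul_sum,
      ← Finset.sum_add_distrib]
    refine Finset.sum_congr rfl fun j _ => ?_
    rw [hJ]
    field_simp
    ring
  have h2 : |∑ i, ∑ j, v i * v j * (M i j - J i j)| ≤ ∑ _i : Fin h, ∑ _j : Fin h, ‖v‖ ^ 2 * τ := by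
    refine (Finset.abs_sum_le_sum_abs _ _).trans (Finset.sum_le_sum fun i _ => ?_)
    refine (Finset.abs_sum_le_sum_abs _ _).trans (Finset.sum_le_sum fun j _ => ?_)
    rw [abs_mul, abs_mul, abs_sub_comm, sq]
    have hi : |v i| ≤ ‖v‖ := PiLp.norm_apply_le v i
    have hj : |v j| ≤ ‖v‖ := PiLp.norm_apply_le v j
    gcongr
    exact hJM i j
  -- This turns the absolute error `h² τ ‖v‖²` into an error relative to the limiting form `‖S v‖²`.
  have h3 : ‖v‖ ≤
      ‖(S.symm : EuclideanSpace ℝ (Fin h) →L[ℝ] EuclideanSpace ℝ (Fin h))‖ * ‖S v‖ := by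
    have := (S.symm : EuclideanSpace ℝ (Fin h) →L[ℝ] EuclideanSpace ℝ (Fin h)).le_opNorm (S v)
    simpa using this
  rw [h1, abs_mul, abs_of_pos hc]
  calc c * |∑ i, ∑ j, v i * v j * (M i j - J i j)|
      ≤ c * ∑ _i : Fin h, ∑ _j : Fin h, ‖v‖ ^ 2 * τ := by gcongr
    _ = c * ((h : ℝ) ^ 2 * (‖v‖ ^ 2 * τ)) := by
        simp only [Finset.sum_const, Finset.card_univ, Fintype.card_fin, nsmul_eq_mul]
        ring
    _ ≤ c * ((h : ℝ) ^ 2 *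
        ((‖(S.symm : EuclideanSpace ℝ (Fin h) →L[ℝ] EuclideanSpace ℝ (Fin h))‖ * ‖S v‖) ^ 2 *
          τ)) := by gcongr
    _ = _ := by ring

end Hessian

/-! ### Deterministic approximation of the statistics -/

section Statistics

variable {h k m : ℕ} {𝒪 ℳ : ℕ → Type*} [∀ n, MeasurableSpace (𝒪 n)] [∀ n, MeasurableSpace (ℳ n)]
  {S : SamplingModel h 𝒪 ℳ}

/-- The statistics are close to their quadratic approximations at a realization of the data where
the information matrices are close to their limit and the estimators are close to the true
value. -/
lemma statistics_near (hm : 0 < m) (e : Estimators S m) {n : ℕ} (hn : 0 < n)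
    (X : Fin m → 𝒪 n × ℳ n) {ψstar : EuclideanSpace ℝ (Fin h)}
    {θ : EuclideanSpace ℝ (Fin h) → EuclideanSpace ℝ (Fin k)} {θ₀ : EuclideanSpace ℝ (Fin k)}
    (hθ : θ ψstar = θ₀) {info : Matrix (Fin h) (Fin h) ℝ}
    (T : EuclideanSpace ℝ (Fin h) ≃L[ℝ] EuclideanSpace ℝ (Fin h))
    (hT : ∀ v, ‖T v‖ ^ 2 = v.ofLp ⬝ᵥ info.mulVec v.ofLp)
    (N : Submodule ℝ (EuclideanSpace ℝ (Fin h))) {δ ρ τ K : ℝ}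
    (hρ : 0 ≤ ρ) (hρ' : ρ ≤ 1 / 2) (hδ : 0 < δ)
    (hball : Metric.ball ψstar δ ⊆ S.Ψ)
    (hL : ∀ ℓ, ContDiffOn ℝ 2 (S.loglik n (X ℓ)) S.Ψ)
    (hmle : ∀ ℓ, IsUniqueScoreMaximizer S.Ψ (S.loglik n (X ℓ)) (e.mle n (X ℓ)))
    (havg : IsMaxOn (fun ψ => S.avgLoglik n X (fun _ => ψ)) S.Ψ (e.avgMle n X))
    (havg₀ : θ (e.avgMle₀ n X) = θ₀ ∧
      IsMaxOn (fun ψ => S.avgLoglik n X (fun _ => ψ)) {ψ ∈ S.Ψ | θ ψ = θ₀} (e.avgMle₀ n X))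
    (hb : ∀ ℓ, e.mle n (X ℓ) ∈ Metric.ball ψstar δ)
    (hb' : e.avgMle n X ∈ Metric.ball ψstar δ) (hb₀ : e.avgMle₀ n X ∈ Metric.ball ψstar δ)
    (hτ : 0 ≤ τ)
    (hτρ : (h : ℝ) ^ 2 *
      ‖(T.symm : EuclideanSpace ℝ (Fin h) →L[ℝ] EuclideanSpace ℝ (Fin h))‖ ^ 2 * τ ≤ ρ)
    (hinfo : ∀ ℓ, ∀ ψ ∈ Metric.ball ψstar δ, ∀ i j, |S.obsInfo n (X ℓ) ψ i j - info i j| ≤ τ)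
    (hK : ∀ ℓ, ‖√(n : ℝ) • T (e.mle n (X ℓ) - ψstar)‖ ≤ K)
    (hN : ∀ ψ ∈ Metric.ball ψstar δ, θ ψ = θ₀ →
      ∃ w ∈ N, ‖T (ψ - ψstar) - w‖ ≤ ρ * ‖T (ψ - ψstar)‖)
    (hN' : ∀ w ∈ N, ‖w‖ ≤ K / √(n : ℝ) →
      ∃ ψ ∈ Metric.ball ψstar δ, θ ψ = θ₀ ∧ ‖T (ψ - ψstar) - w‖ ≤ ρ * ‖w‖) :
    |e.dHat n X - ‖mean (fun ℓ => √(n : ℝ) • T (e.mle n (X ℓ) - ψstar)) -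
      N.starProjection (mean (fun ℓ => √(n : ℝ) • T (e.mle n (X ℓ) - ψstar)))‖ ^ 2| ≤
        42 * ρ * K ^ 2 ∧
    |e.deltaBar n X - e.deltaHat n X -
      spread (fun ℓ => √(n : ℝ) • T (e.mle n (X ℓ) - ψstar))| ≤ ρ * K ^ 2 ∧
    0 ≤ e.deltaBar n X - e.deltaHat n X := by
  have hn' : (0 : ℝ) < n := by exact_mod_cast hn
  have hsn : 0 < √(n : ℝ) := Real.sqrt_pos.2 hn'
  have hm' : (m : ℝ) ≠ 0 := by positivity
  set U := Metric.ball ψstar δ with hU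
  set x : EuclideanSpace ℝ (Fin h) → EuclideanSpace ℝ (Fin h) :=
    fun ψ => √(n : ℝ) • T (ψ - ψstar) with hx
  set a : Fin m → EuclideanSpace ℝ (Fin h) := fun ℓ => x (e.mle n (X ℓ)) with ha
  -- The minimum of `Λ` over `Ψ` is `δ̄ - δ̂`, and its minimum over the null set is larger by
  -- exactly `d̂`.
  set Λ : EuclideanSpace ℝ (Fin h) → ℝ :=
    fun ψ => e.deltaBar n X - 2 * S.avgLoglik n X (fun _ => ψ) with hΛ
  have hΛsum : ∀ ψ, Λ ψ = (m : ℝ)⁻¹ *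
      ∑ ℓ, 2 * (S.loglik n (X ℓ) (e.mle n (X ℓ)) - S.loglik n (X ℓ) ψ) := by
    intro ψ
    rw [← Finset.mul_sum, Finset.sum_sub_distrib]
    simp only [hΛ, Estimators.deltaBar, SamplingModel.avgLoglik]
    ring
  have hxsub : ∀ ψ ℓ, (n : ℝ) * ‖T (ψ - e.mle n (X ℓ))‖ ^ 2 = ‖x ψ - a ℓ‖ ^ 2 := by
    intro ψ ℓ
    rw [ha, hx, ← smul_sub, ← map_sub, sub_sub_sub_cancel_right, norm_smul, mul_pow,
      Real.norm_eq_abs, sq_abs, Real.sq_sqrt hn'.le]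
  -- Each log-likelihood is expanded around its own maximizer, where its gradient vanishes; no
  -- linear term remains.
  have hquad : ∀ ψ ∈ U, |Λ ψ - (spread a + ‖x ψ - mean a‖ ^ 2)| ≤
      ρ * (spread a + ‖x ψ - mean a‖ ^ 2) := by
    intro ψ hψ
    rw [← mean_norm_sq_sub hm, hΛsum, ← mul_sub, ← Finset.sum_sub_distrib, abs_mul,
      abs_of_nonneg (by positivity : (0 : ℝ) ≤ (m : ℝ)⁻¹), mul_left_comm]
    refine mul_le_mul_of_nonneg_left ?_ (by positivity)
    rw [Finset.mul_sum]
    refine (Finset.abs_sum_le_sum_abs _ _).trans (Finset.sum_le_sum fun ℓ _ => ?_)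
    rw [← hxsub]
    refine abs_two_mul_sub_sub_le (q := fun v => (n : ℝ) * ‖T v‖ ^ 2) Metric.isOpen_ball
      (convex_ball _ _) ((hL ℓ).mono hball) (hb ℓ) hψ
      (((hmle ℓ).2.2 _ (hmle ℓ).1).2 rfl) fun ξ hξ v => ?_
    refine (abs_hessian_add_le T hT _ hn' hτ (J := S.obsInfo n (X ℓ) ξ) (fun i j => ?_)
      (hinfo ℓ ξ hξ) v).trans (mul_le_mul_of_nonneg_right hτρ (by positivity))
    rw [SamplingModel.obsInfo, Matrix.of_apply, iteratedFDeriv_two_apply]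
    rfl
  have hKm : ‖mean a‖ ≤ K := norm_mean_le hm hK
  have hKs : spread a ≤ K ^ 2 := spread_le hm hK
  have hK0 : 0 ≤ K := (norm_nonneg _).trans hKm
  have hxmean : x (mean fun ℓ => e.mle n (X ℓ)) = mean a := by
    simp only [hx, ha, mean, map_sub, map_smul, map_sum, smul_sub, Finset.smul_sum,
      Finset.sum_sub_distrib]
    simp only [Finset.sum_const, Finset.card_univ, Fintype.card_fin]
    rw [← Nat.cast_smul_eq_nsmul ℝ, smul_smul, mul_inv_cancel₀ hm', one_smul]
    congr 1
    exact Finset.sum_congr rfl fun ℓ _ => smul_comm _ _ _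
  -- The average of the estimators is the competitor sitting at the vertex of the paraboloid.
  have hmeanU : (mean fun ℓ => e.mle n (X ℓ)) ∈ U := by
    rw [mean, Finset.smul_sum]
    exact (convex_ball ψstar δ).sum_mem (fun _ _ => by positivity) (by simp [hm'])
      fun ℓ _ => hb ℓ
  have hstar : ψstar ∈ U := Metric.mem_ball_self hδ
  have hle : ∀ ψ ∈ U, Λ (e.avgMle n X) ≤ Λ ψ := by
    intro ψ hψ
    have := havg (hball hψ)
    simp only [Set.mem_ofPred_eq] at this
    simp only [hΛ]
    linarith
  have hle₀ : ∀ ψ ∈ U, θ ψ = θ₀ → Λ (e.avgMle₀ n X) ≤ Λ ψ := by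
    intro ψ hψ hψ₀
    have := havg₀.2 (show ψ ∈ {ψ ∈ S.Ψ | θ ψ = θ₀} from ⟨hball hψ, hψ₀⟩)
    simp only [Set.mem_ofPred_eq] at this
    simp only [hΛ]
    linarith
  have h1 : |Λ (e.avgMle n X) - spread a| ≤ ρ * spread a :=
    abs_min_sub_spread_le hρ' hquad hb' hmeanU hxmean (hle _ hmeanU)
  have hproj : ‖N.starProjection (mean a)‖ ≤ K :=
    (N.norm_starProjection_apply_le (mean a)).trans hKm
  -- A null parameter near the projection of the vertex onto `N`, brought back to the scale `1/√n`;
  -- `ψstar` itself serves as the crude competitor.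
  obtain ⟨ψ₁, hψ₁, hθ₁, hψ₁N⟩ := hN' ((√(n : ℝ))⁻¹ • N.starProjection (mean a))
    (N.smul_mem _ (N.starProjection_apply_mem _)) (by
      rw [norm_smul, norm_inv, Real.norm_of_nonneg hsn.le, inv_mul_eq_div]
      gcongr)
  have hscale : ∀ v w : EuclideanSpace ℝ (Fin h),
      ‖√(n : ℝ) • v - w‖ = √(n : ℝ) * ‖v - (√(n : ℝ))⁻¹ • w‖ := by
    intro v w
    rw [← Real.norm_of_nonneg hsn.le, ← norm_smul, Real.norm_of_nonneg hsn.le, smul_sub, smul_smul,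
      mul_inv_cancel₀ hsn.ne', one_smul]
  have hx₁ : ‖x ψ₁ - N.starProjection (mean a)‖ ≤ ρ * K := by
    rw [hx, hscale]
    calc √(n : ℝ) * ‖T (ψ₁ - ψstar) - (√(n : ℝ))⁻¹ • N.starProjection (mean a)‖
        ≤ √(n : ℝ) * (ρ * ‖(√(n : ℝ))⁻¹ • N.starProjection (mean a)‖) := by gcongr
      _ = ρ * ‖N.starProjection (mean a)‖ := by
          rw [norm_smul, norm_inv, Real.norm_of_nonneg hsn.le]
          field_simp
      _ ≤ ρ * K := by gcongr
  have hx₀ : ∃ w ∈ N, ‖x (e.avgMle₀ n X) - w‖ ≤ ρ * ‖x (e.avgMle₀ n X)‖ := by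
    obtain ⟨w, hw, hw'⟩ := hN _ hb₀ havg₀.1
    refine ⟨√(n : ℝ) • w, N.smul_mem _ hw, ?_⟩
    rw [hx, ← smul_sub, norm_smul, norm_smul, mul_left_comm]
    gcongr
  have h2 := abs_constrained_min_sub_le N hρ hρ' hquad hKm hKs hb₀ hψ₁ hstar
    (hle₀ _ hψ₁ hθ₁) (hle₀ _ hstar hθ) hx₁ (by simp [hx]) hx₀
  have h1' : ρ * spread a ≤ ρ * K ^ 2 := by gcongr
  have hV : e.deltaBar n X - e.deltaHat n X = Λ (e.avgMle n X) := rfl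
  have hd : e.dHat n X = Λ (e.avgMle₀ n X) - Λ (e.avgMle n X) := by
    simp only [Estimators.dHat, hΛ]
    ring
  refine ⟨?_, ?_, ?_⟩
  -- `42 = 41 + 1`: the constrained error plus that of the free minimum.
  · rw [hd]
    rw [abs_le] at h1 h2 ⊢
    constructor <;> linarith [h1.1, h1.2, h2.1, h2.2]
  · rw [hV]
    exact h1.trans h1'
  -- Exact nonnegativity, since each `ψ̂^ℓ` maximizes its own log-likelihood; it keeps the
  -- denominator of the statistic away from zero.
  · rw [hV, hΛsum]
    refine mul_nonneg (by positivity) (Finset.sum_nonneg fun ℓ _ => ?_)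
    have := (hmle ℓ).2.1 (e.avgMle_mem n X)
    simp only [Set.mem_ofPred_eq] at this
    linarith

end Statistics

/-! ### Measurability of the statistic -/

section Measurability

variable {h m : ℕ} {𝒪 ℳ : ℕ → Type*} [∀ n, MeasurableSpace (𝒪 n)] [∀ n, MeasurableSpace (ℳ n)]
  {S : SamplingModel h 𝒪 ℳ} {Ω : Type*} [MeasurableSpace Ω] {n : ℕ}

/-- A Carathéodory argument: continuity in the parameter and measurability in the data give joint
measurability. Both hold only on `Ψ`, hence the subtype. -/
lemma measurable_loglik_comp (hL : ∀ x, ContDiffOn ℝ 2 (S.loglik n x) S.Ψ) {g : Ω → 𝒪 n × ℳ n}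
    (hg : Measurable g) {ψ : Ω → EuclideanSpace ℝ (Fin h)} (hψ : Measurable ψ)
    (hψΨ : ∀ ω, ψ ω ∈ S.Ψ) : Measurable fun ω => S.loglik n (g ω) (ψ ω) := by
  have hu : Measurable (Function.uncurry fun (ψ : S.Ψ) (x : 𝒪 n × ℳ n) => S.loglik n x ψ) :=
    measurable_uncurry_of_continuous_of_measurable
      (fun x => continuousOn_iff_continuous_domRestrict.1 (hL x).continuousOn)
      (fun ψ => Real.measurable_log.comp (S.measurable_f n ψ ψ.2))
  exact hu.comp ((hψ.subtype_mk (h := hψΨ)).prodMk hg)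

lemma measurable_avgLoglik_comp (hL : ∀ x, ContDiffOn ℝ 2 (S.loglik n x) S.Ψ)
    {ψ : Fin m → (Fin m → 𝒪 n × ℳ n) → EuclideanSpace ℝ (Fin h)} (hψ : ∀ ℓ, Measurable (ψ ℓ))
    (hψΨ : ∀ ℓ X, ψ ℓ X ∈ S.Ψ) : Measurable fun X => S.avgLoglik n X (fun ℓ => ψ ℓ X) :=
  (Finset.measurable_sum _ fun ℓ _ =>
    measurable_loglik_comp hL (measurable_pi_apply ℓ) (hψ ℓ) (hψΨ ℓ)).const_mul _

lemma measurable_DHatRob (hL : ∀ x, ContDiffOn ℝ 2 (S.loglik n x) S.Ψ) (e : Estimators S m)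
    (k : ℕ) : Measurable (e.DHatRob k n) := by
  have h1 := measurable_avgLoglik_comp (m := m) hL (ψ := fun ℓ X => e.mle n (X ℓ))
    (fun ℓ => (e.measurable_mle n).comp (measurable_pi_apply ℓ)) fun ℓ X => e.mle_mem n _
  have h2 := measurable_avgLoglik_comp hL (ψ := fun (_ : Fin m) X => e.avgMle n X)
    (fun ℓ => e.measurable_avgMle n) fun ℓ X => e.avgMle_mem n _
  have h3 := measurable_avgLoglik_comp hL (ψ := fun (_ : Fin m) X => e.avgMle₀ n X)
    (fun ℓ => e.measurable_avgMle₀ n) fun ℓ X => e.avgMle₀_mem n _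
  exact ((h2.sub h3).const_mul 2).div
    (((((h1.const_mul 2).sub (h2.const_mul 2)).const_mul _).const_add 1).const_mul _)

end Measurability

/-! ### Continuity of matrix inversion -/

section MatrixInverse

/-- If the inverse of a matrix is close to the inverse of an invertible matrix, so are the
matrices themselves. -/
lemma exists_inverse_near {h : ℕ} {M T : Matrix (Fin h) (Fin h) ℝ} (hM : IsUnit M.det)
    (hT : IsUnit T.det) {τ : ℝ} (hτ : 0 < τ) :
    ∃ ε > 0, ∀ J : Matrix (Fin h) (Fin h) ℝ, (∀ i j, |(T⁻¹ * (J⁻¹ - M⁻¹)) i j| < ε) →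
      ∀ i j, |J i j - M i j| ≤ τ := by
  -- `f` recovers `J⁻¹` from `Y = T⁻¹ (J⁻¹ - M⁻¹)`, so the claim is continuity of inversion at `f 0
  -- = M⁻¹`.
  set f : (Fin h → Fin h → ℝ) → Matrix (Fin h) (Fin h) ℝ := fun Y => T * Matrix.of Y + M⁻¹ with hf
  have hfc : Continuous f := by
    refine Continuous.add (Continuous.matrix_mul continuous_const ?_) continuous_const
    exact continuous_id
  have hf0 : f 0 = M⁻¹ := by
    have : Matrix.of (0 : Fin h → Fin h → ℝ) = 0 := rfl
    simp [hf, this]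
  have hdet0 : (f 0).det ≠ 0 := by
    rw [hf0]
    exact (Matrix.isUnit_nonsing_inv_det M hM).ne_zero
  have hdet : ∀ᶠ Y in 𝓝 (0 : Fin h → Fin h → ℝ), (f Y).det ≠ 0 :=
    (hfc.matrix_det.continuousAt).eventually_ne hdet0
  have hinv : ContinuousAt (fun Y => (f Y)⁻¹) 0 := by
    refine ContinuousAt.comp (g := fun A : Matrix (Fin h) (Fin h) ℝ => A⁻¹)
      (continuousAt_matrix_inv _ ?_) hfc.continuousAt
    simp only [Ring.inverse_eq_inv']
    exact continuousAt_inv₀ hdet0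
  have hclose : ∀ᶠ Y in 𝓝 (0 : Fin h → Fin h → ℝ), ∀ i j, |(f Y)⁻¹ i j - M i j| < τ := by
    simp only [eventually_all]
    intro i j
    have h1 : ContinuousAt (fun Y => (f Y)⁻¹ i j) 0 :=
      ContinuousAt.comp (g := fun A : Matrix (Fin h) (Fin h) ℝ => A i j)
        (continuous_id.matrix_elem i j).continuousAt hinv
    refine (h1.sub continuousAt_const).abs.eventually_lt_const ?_
    have hval : (f 0)⁻¹ = M := by rw [hf0, Matrix.nonsing_inv_nonsing_inv M hM]
    change |(f 0)⁻¹ i j - M i j| < τ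
    rw [hval, sub_self, abs_zero]
    exact hτ
  obtain ⟨ε, hε, hball⟩ := Metric.eventually_nhds_iff.1 (hdet.and hclose)
  refine ⟨ε, hε, fun J hJ => ?_⟩
  obtain ⟨h1, h2⟩ := hball (y := fun i j => (T⁻¹ * (J⁻¹ - M⁻¹)) i j) (by
    rw [dist_zero_right, pi_norm_lt_iff hε]
    intro i
    rw [pi_norm_lt_iff hε]
    exact fun j => hJ i j)
  have h3 : f (fun i j => (T⁻¹ * (J⁻¹ - M⁻¹)) i j) = J⁻¹ := by
    change T * (T⁻¹ * (J⁻¹ - M⁻¹)) + M⁻¹ = J⁻¹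
    rw [Matrix.mul_nonsing_inv_cancel_left _ _ hT, sub_add_cancel]
  rw [h3] at h1 h2
  -- A singular `J` would have inverse determinant `0` by the default value of `Ring.inverse`,
  -- contradicting `h1`.
  have hJdet : IsUnit J.det := by
    rw [Matrix.det_nonsing_inv] at h1
    by_contra hne
    exact h1 (Ring.inverse_non_unit _ hne)
  rw [Matrix.nonsing_inv_nonsing_inv J hJdet] at h2
  exact fun i j => (h2 i j).le

end MatrixInverse

/-! ### Events of probability tending to one -/

section HighProbability

variable {Ω : ℕ → Type*} [∀ n, MeasurableSpace (Ω n)] {P : ∀ n, Measure (Ω n)}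

/-- `p` holds with probability tending to one. -/
def WithHighProb (P : ∀ n, Measure (Ω n)) (p : ∀ n, Ω n → Prop) : Prop :=
  Tendsto (fun n => P n {ω | ¬ p n ω}) atTop (𝓝 0)

lemma WithHighProb.mono {p q : ∀ n, Ω n → Prop} (hp : WithHighProb P p)
    (hpq : ∀ᶠ n in atTop, ∀ ω, p n ω → q n ω) : WithHighProb P q := by
  refine tendsto_of_tendsto_of_tendsto_of_le_of_le' tendsto_const_nhds hp
    (Eventually.of_forall fun _ => zero_le) ?_
  filter_upwards [hpq] with n hn
  exact measure_mono fun ω hω hpω => hω (hn ω hpω)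

lemma WithHighProb.and {p q : ∀ n, Ω n → Prop} (hp : WithHighProb P p) (hq : WithHighProb P q) :
    WithHighProb P fun n ω => p n ω ∧ q n ω := by
  have := hp.add hq
  rw [add_zero] at this
  refine tendsto_of_tendsto_of_tendsto_of_le_of_le tendsto_const_nhds this
    (fun _ => zero_le) fun n => ?_
  refine (measure_mono fun ω hω => ?_).trans (measure_union_le _ _)
  by_cases h : p n ω
  · exact Or.inr fun hq => hω ⟨h, hq⟩
  · exact Or.inl h

lemma WithHighProb.forall {ι : Type*} [Fintype ι] {p : ι → ∀ n, Ω n → Prop}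
    (hp : ∀ i, WithHighProb P (p i)) : WithHighProb P fun n ω => ∀ i, p i n ω := by
  have : Tendsto (fun n => ∑ i, P n {ω | ¬ p i n ω}) atTop (𝓝 0) := by
    simpa using tendsto_finsetSum Finset.univ fun i _ => hp i
  refine tendsto_of_tendsto_of_tendsto_of_le_of_le tendsto_const_nhds this
    (fun _ => zero_le) fun n => ?_
  refine (measure_mono fun ω hω => ?_).trans (measure_iUnion_fintype_le _ _)
  simpa using hω

lemma withHighProb_of_ae {p : ∀ n, Ω n → Prop} (hp : ∀ᶠ n in atTop, ∀ᵐ ω ∂(P n), p n ω) :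
    WithHighProb P p := by
  refine tendsto_const_nhds.congr' ?_
  filter_upwards [hp] with n hn
  exact hn.symm

end HighProbability

/-! ### Boundedness in probability -/

section Tightness

/-- Sequences that converge in distribution are bounded in probability. -/
lemma exists_norm_bound_of_tendstoInDistribution
    {V : Type*} [NormedAddCommGroup V] [InnerProductSpace ℝ V] [FiniteDimensional ℝ V]
    [MeasurableSpace V] [BorelSpace V] {Ω : ℕ → Type*} [∀ n, MeasurableSpace (Ω n)]
    {Ω' : Type*} [MeasurableSpace Ω'] {P' : Measure Ω'} [IsProbabilityMeasure P']
    {P : ∀ n, Measure (Ω n)} [∀ n, IsProbabilityMeasure (P n)] {X : ∀ n, Ω n → V} {Z : Ω' → V}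
    (hX : TendstoInDistribution X atTop Z P P') {η : ℝ≥0∞} (hη : 0 < η) :
    ∃ K, 0 < K ∧ ∀ n, P n {ω | K < ‖X n ω‖} ≤ η := by
  have hXt := ProbabilityMeasure.tendsto_iff_tendsto_charFun.1 hX.tendsto
  simp only [ProbabilityMeasure.coe_mk] at hXt
  have : ∀ n, IsProbabilityMeasure ((P n).map (X n)) := fun n =>
    Measure.isProbabilityMeasure_map (hX.forall_aemeasurable n)
  have : IsProbabilityMeasure (P'.map Z) := Measure.isProbabilityMeasure_map hX.aemeasurable_limit
  have ht : IsTightMeasureSet (Set.range fun n => (P n).map (X n)) :=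
    isTightMeasureSet_of_tendsto_charFun (f := charFun (P'.map Z))
      (by fun_prop) hXt
  obtain ⟨C, hC, h⟩ := isTightMeasureSet_iff_exists_isCompact_measure_compl_le.1 ht η hη
  obtain ⟨K, hK⟩ := hC.isBounded.subset_closedBall 0
  refine ⟨max K 1, by positivity, fun n => ?_⟩
  refine le_trans ?_ (h _ ⟨n, rfl⟩)
  refine le_trans ?_ (Measure.le_map_apply (hX.forall_aemeasurable n) _)
  refine measure_mono fun ω hω hmem => ?_
  have := hK hmem
  rw [mem_closedBall_zero_iff] at this
  exact absurd (this.trans (le_max_left K 1)) (not_le.2 hω)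

end Tightness

/-! ### The limiting functional -/

section Limit

variable {E : Type*} [NormedAddCommGroup E] [InnerProductSpace ℝ E] [FiniteDimensional ℝ E]
  [MeasurableSpace E] [BorelSpace E] {m : ℕ}

/-- The asymptotic form of the statistic, as a function of the standardized estimators. -/
def limitStat (N : Submodule ℝ E) [N.HasOrthogonalProjection] (k : ℕ) (c : ℝ) (a : Fin m → E) : ℝ :=
  ‖mean a - N.starProjection (mean a)‖ ^ 2 / (k * (1 + c * spread a))

lemma continuous_limitStat (N : Submodule ℝ E) {k : ℕ} (hk : 0 < k) {c : ℝ} (hc : 0 ≤ c) :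
    Continuous fun y : Stack m E => limitStat N k c fun ℓ => y none + y (some ℓ) := by
  have hmean : Continuous fun y : Stack m E => mean fun ℓ : Fin m => y none + y (some ℓ) := by
    unfold mean
    fun_prop
  unfold limitStat
  refine Continuous.div (by fun_prop) ?_ fun y => ?_
  · unfold spread
    fun_prop
  · have := spread_nonneg fun ℓ : Fin m => y none + y (some ℓ)
    positivity

/-- The base component shifts all vectors equally, so it enters the mean but cancels in the spread.
The residual of projection onto `N` is the projection onto `Nᗮ`. -/
lemma limitStat_stackScale (hm : 0 < m) (N : Submodule ℝ E) (k : ℕ) (c : ℝ) {r : ℝ} (hr : 0 ≤ r)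
    (g : Stack m E) :
    limitStat N k c (fun ℓ => stackScale (√(1 + r)) (√r) g none +
      stackScale (√(1 + r)) (√r) g (some ℓ)) =
      ‖Nᗮ.orthogonalProjectionOnto (√(1 + r) • g none + √r • stackMean m E g)‖ ^ 2 /
        (k * (1 + c * ((m : ℝ)⁻¹ * (r * ∑ ℓ, ‖g (some ℓ) - stackMean m E g‖ ^ 2)))) := by
  have hm' : (m : ℝ) ≠ 0 := by positivity
  have hmean : mean (fun ℓ : Fin m => stackScale (√(1 + r)) (√r) g none +
      stackScale (√(1 + r)) (√r) g (some ℓ)) = √(1 + r) • g none + √r • stackMean m E g := by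
    simp only [mean, stackScale, stackMk, Option.elim, Finset.sum_add_distrib, Finset.sum_const,
      Finset.card_univ, Fintype.card_fin, smul_add, stackMean_apply]
    rw [← Nat.cast_smul_eq_nsmul ℝ, smul_smul, inv_mul_cancel₀ hm', one_smul, ← Finset.smul_sum,
      smul_comm]
  have hspread : spread (fun ℓ : Fin m => stackScale (√(1 + r)) (√r) g none +
      stackScale (√(1 + r)) (√r) g (some ℓ)) =
      (m : ℝ)⁻¹ * (r * ∑ ℓ, ‖g (some ℓ) - stackMean m E g‖ ^ 2) := by
    rw [spread, hmean]
    congr 1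
    rw [Finset.mul_sum]
    refine Finset.sum_congr rfl fun ℓ _ => ?_
    simp only [stackScale, stackMk, Option.elim]
    rw [add_sub_add_left_eq_sub, ← smul_sub, norm_smul, mul_pow, Real.norm_eq_abs, sq_abs,
      Real.sq_sqrt hr]
  rw [limitStat, hspread, hmean]
  congr 2
  rw [← Submodule.norm_coe, ← Submodule.starProjection_apply, Submodule.starProjection_orthogonal_val]

end Limit

/-! ### Stability of the ratio -/

section Ratio

/-- Every denominator that occurs is at least 1, because `1 ≤ k` and `c`, `V`, `V'` are nonnegative.
-/
lemma abs_ratio_sub_le {k : ℕ} (hk : 0 < k) {c d d' V V' : ℝ} (hc : 0 ≤ c) (hV : 0 ≤ V)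
    (hV' : 0 ≤ V') :
    |d / (k * (1 + c * V)) - d' / (k * (1 + c * V'))| ≤ |d - d'| + |d'| * (c * |V - V'|) := by
  have hk' : (1 : ℝ) ≤ k := by exact_mod_cast hk
  have hcV : 0 ≤ c * V := mul_nonneg hc hV
  have hcV' : 0 ≤ c * V' := mul_nonneg hc hV'
  have h1 : 1 ≤ k * (1 + c * V) := by nlinarith
  have h2 : 1 ≤ 1 + c * V := by linarith
  have h3 : 1 ≤ k * (1 + c * V') := by nlinarith
  have key : d / (k * (1 + c * V)) - d' / (k * (1 + c * V')) =
      (d - d') / (k * (1 + c * V)) - d' * (c * (V - V')) / ((1 + c * V) * (k * (1 + c * V'))) := by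
    have : (k : ℝ) ≠ 0 := by positivity
    field_simp
    ring
  rw [key]
  refine (abs_sub _ _).trans (add_le_add ?_ ?_)
  · rw [abs_div]
    refine div_le_self (abs_nonneg _) ?_
    rwa [abs_of_pos (by linarith)]
  · rw [abs_div, abs_mul, abs_mul, abs_of_nonneg hc]
    refine div_le_self (by positivity) ?_
    have h4 : 1 ≤ (1 + c * V) * (k * (1 + c * V')) := by nlinarith
    rwa [abs_of_pos (by linarith)]

end Ratio

/-- The characteristic function in terms of integrals of cosines and sines. -/
lemma integral_exp_inner_eq {α V : Type*} [MeasurableSpace α] [NormedAddCommGroup V]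
    [InnerProductSpace ℝ V] [MeasurableSpace V] [BorelSpace V] [SecondCountableTopology V]
    (ν : Measure α) [IsFiniteMeasure ν] {Z : α → V} (hZ : Measurable Z) (s : V) :
    ∫ y, Complex.exp (⟪Z y, s⟫ * Complex.I) ∂ν =
      ((∫ y, Real.cos ⟪Z y, s⟫ ∂ν : ℝ) : ℂ) + ((∫ y, Real.sin ⟪Z y, s⟫ ∂ν : ℝ) : ℂ) *
        Complex.I := by
  have hin : Measurable fun y => ⟪Z y, s⟫ := hZ.inner measurable_const
  rw [← integral_complex_ofReal, ← integral_complex_ofReal, ← integral_mul_const, ← integral_add]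
  · refine integral_congr_ae (ae_of_all _ fun y => ?_)
    simp [Complex.exp_mul_I]
  · exact (Integrable.of_bound (Real.measurable_cos.comp hin).aestronglyMeasurable 1
      (ae_of_all _ fun y => Real.abs_cos_le_one _)).ofReal
  · exact (Integrable.of_bound (Real.measurable_sin.comp hin).aestronglyMeasurable 1
      (ae_of_all _ fun y => Real.abs_sin_le_one _)).ofReal.mul_const _

/-! ### Identification of the limit law -/

section LimitLaw

variable {E : Type*} [NormedAddCommGroup E] [InnerProductSpace ℝ E] [FiniteDimensional ℝ E]
  [MeasurableSpace E] [BorelSpace E] {m : ℕ}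

/-- The law of the asymptotic form of the statistic at the Gaussian limit. -/
lemma map_limitStat_eq (hm : 1 < m) {k : ℕ} (N : Submodule ℝ E)
    (hN : Module.finrank ℝ Nᗮ = k) (hE : 0 < Module.finrank ℝ E) {r : ℝ} (hr : 0 ≤ r)
    {Ω' : Type*} [MeasurableSpace Ω'] {P' : Measure Ω'} [IsProbabilityMeasure P'] {M₁ M₃ : Ω' → ℝ}
    (hM₁ : HasLaw M₁ ((chiSquared k).map (fun t => t / (k : ℝ))) P')
    (hM₃ : HasLaw M₃ ((chiSquared (Module.finrank ℝ E * (m - 1))).map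
      (fun t => t / ((Module.finrank ℝ E * (m - 1) : ℕ) : ℝ))) P')
    (hM : IndepFun M₁ M₃ P') :
    P'.map (fun ω => (1 + (1 + 1 / (m : ℝ)) * r) * M₁ ω / (1 + (1 + 1 / (m : ℝ)) * r * M₃ ω)) =
      (stdGaussian (Stack m E)).map (fun g => limitStat N k
        (((m : ℝ) + 1) / ((Module.finrank ℝ E : ℝ) * ((m : ℝ) - 1))) fun ℓ =>
          stackScale (√(1 + r)) (√r) g none + stackScale (√(1 + r)) (√r) g (some ℓ)) := by
  have hm0 : 0 < m := by omega
  have hm' : (0 : ℝ) < m := by exact_mod_cast hm0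
  have hm1 : (0 : ℝ) < (m : ℝ) - 1 := by
    have : (1 : ℝ) < m := by exact_mod_cast hm
    linarith
  have hE' : (0 : ℝ) < Module.finrank ℝ E := by exact_mod_cast hE
  set p := Module.finrank ℝ E with hp
  have hcast : ((p * (m - 1) : ℕ) : ℝ) = p * ((m : ℝ) - 1) := by
    rw [Nat.cast_mul, Nat.cast_sub hm.le, Nat.cast_one]
  set c₀ : ℝ := 1 + (1 + 1 / (m : ℝ)) * r with hc₀
  have hc₀' : 0 < c₀ := by positivity
  set φ : ℝ × ℝ → ℝ := fun q => c₀ * q.1 / (1 + (1 + 1 / (m : ℝ)) * r * q.2) with hφ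
  have hφm : Measurable φ := by fun_prop
  set sc : ℝ × ℝ → ℝ × ℝ := Prod.map (fun t => t / (k : ℝ))
    (fun t => t / ((p * (m - 1) : ℕ) : ℝ)) with hsc
  have hscm : Measurable sc := by
    rw [hsc]
    fun_prop
  set qf : Stack m E → ℝ × ℝ := fun g => (c₀⁻¹ *
      ‖Nᗮ.orthogonalProjectionOnto (√(1 + r) • g none + √r • stackMean m E g)‖ ^ 2,
      ∑ ℓ, ‖g (some ℓ) - stackMean m E g‖ ^ 2) with hqf
  have hqfm : Measurable qf := by
    rw [hqf]
    fun_prop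
  have hL : P'.map (fun ω => c₀ * M₁ ω / (1 + (1 + 1 / (m : ℝ)) * r * M₃ ω)) =
      (((chiSquared k).prod (chiSquared (p * (m - 1)))).map sc).map φ := by
    have h1 : (fun ω => c₀ * M₁ ω / (1 + (1 + 1 / (m : ℝ)) * r * M₃ ω)) =
        φ ∘ fun ω => (M₁ ω, M₃ ω) := rfl
    rw [h1, ← AEMeasurable.map_map_of_aemeasurable hφm.aemeasurable
      (hM₁.aemeasurable.prodMk hM₃.aemeasurable),
      (indepFun_iff_map_prod_eq_prod_map_map hM₁.aemeasurable hM₃.aemeasurable).1 hM, hM₁.map_eq,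
      hM₃.map_eq, Measure.map_prod_map _ _ (by fun_prop) (by fun_prop)]
  have hQ := stdGaussian_map_quadratic_forms hm0 hr Nᗮ
  rw [hN] at hQ
  rw [hL, ← hQ, Measure.map_map hscm hqfm, Measure.map_map hφm (hscm.comp hqfm)]
  congr 1
  ext g
  rw [limitStat_stackScale hm0 N k _ hr]
  simp only [Function.comp, hφ, hsc, hqf, Prod.map, hcast]
  -- Why the estimator carries the factor `(m + 1) / (h (m - 1))`: it turns the limiting spread
  -- `(r/m) s` into `r_m M₃`.
  have e1 : ∀ s : ℝ, (1 + 1 / (m : ℝ)) * r * (s / (p * ((m : ℝ) - 1))) =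
      ((m : ℝ) + 1) / (p * ((m : ℝ) - 1)) * ((m : ℝ)⁻¹ * (r * s)) := by
    intro s
    field_simp
  rw [e1, mul_div_assoc', mul_inv_cancel_left₀ hc₀'.ne', div_div]

end LimitLaw

/-! ### Consequences of the regularity conditions -/

section Model

variable {h k m : ℕ} {𝒪 ℳ : ℕ → Type*} [∀ n, MeasurableSpace (𝒪 n)] [∀ n, MeasurableSpace (ℳ n)]
  {S : SamplingModel h 𝒪 ℳ} {e : Estimators S m} {ψstar : EuclideanSpace ℝ (Fin h)}
  {Ω : ℕ → Type*} [∀ n, MeasurableSpace (Ω n)] {P : ∀ n, Measure (Ω n)}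
  [∀ n, IsProbabilityMeasure (P n)]

lemma isProbabilityMeasure_obsLaw (I : MultipleImputation S m ψstar P) (n : ℕ) :
    IsProbabilityMeasure (S.obsLaw n ψstar) := by
  have := I.isMarkovKernel_imp
  have h1 := I.joint_law n Set.univ (fun _ => Set.univ) .univ fun _ => .univ
  simp only [Set.mem_univ, implies_true, and_self, Set.ofPred_true, measure_univ,
    Finset.prod_const_one, Measure.restrict_univ, lintegral_const, one_mul] at h1
  exact ⟨h1.symm⟩

lemma map_data_eq (I : MultipleImputation S m ψstar P) (n : ℕ) [IsMarkovKernel (I.imp n)]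
    [IsFiniteMeasure (S.obsLaw n ψstar)] :
    (P n).map (fun ω => (I.Xobs n ω, fun ℓ => I.Xmis n ℓ ω)) =
      S.obsLaw n ψstar ⊗ₘ piKernel (Fin m) (I.imp n) := by
  have hmeas : Measurable fun ω => (I.Xobs n ω, fun ℓ => I.Xmis n ℓ ω) :=
    (I.measurable_Xobs n).prodMk (measurable_pi_lambda _ fun ℓ => I.measurable_Xmis n ℓ)
  refine eq_compProd_piKernel _ _ _ fun A B hA hB => ?_
  rw [Measure.map_apply hmeas (hA.prod (MeasurableSet.univ_pi hB)), ← I.joint_law n A B hA hB]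
  congr 1
  ext ω
  simp

lemma map_Xobs_eq (I : MultipleImputation S m ψstar P) (n : ℕ) :
    (P n).map (I.Xobs n) = S.obsLaw n ψstar := by
  have := I.isMarkovKernel_imp
  have := isProbabilityMeasure_obsLaw I n
  have hmeas : Measurable fun ω => (I.Xobs n ω, fun ℓ => I.Xmis n ℓ ω) :=
    (I.measurable_Xobs n).prodMk (measurable_pi_lambda _ fun ℓ => I.measurable_Xmis n ℓ)
  have h1 := congrArg Measure.fst (map_data_eq I n)
  rw [Measure.fst_compProd, Measure.fst, Measure.map_map measurable_fst hmeas] at h1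
  exact h1

variable {I : MultipleImputation S m ψstar P}
  {θ : EuclideanSpace ℝ (Fin h) → EuclideanSpace ℝ (Fin k)} {θ₀ : EuclideanSpace ℝ (Fin k)}
  {info 𝒯 : Matrix (Fin h) (Fin h) ℝ} {r : ℝ}

/-- Joint convergence of the standardized observed-data estimator and of the standardized
deviations of the completed-data estimators from it. -/
lemma RegularityConditions.tendsto_stack
    (hRC : RegularityConditions S e P I θ θ₀ info 𝒯 r)
    (T : EuclideanSpace ℝ (Fin h) ≃L[ℝ] EuclideanSpace ℝ (Fin h))
    (T' : EuclideanSpace ℝ (Fin h) → EuclideanSpace ℝ (Fin h))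
    (hT' : ∀ v t, ⟪T v, t⟫ = ⟪v, T' t⟫)
    (hTT' : ∀ t, (T' t).ofLp ⬝ᵥ info⁻¹.mulVec (T' t).ofLp = ‖t‖ ^ 2) :
    TendstoInDistribution (fun (n : ℕ) ω =>
      stackMk (√(n : ℝ) • T (e.obsMle n (I.Xobs n ω) - ψstar)) fun ℓ : Fin m =>
        √(n : ℝ) • T (e.mle n (I.completed n ω ℓ) - e.obsMle n (I.Xobs n ω))) atTop
      (stackScale (√(1 + r)) (√r)) P (stdGaussian (Stack m (EuclideanSpace ℝ (Fin h)))) := by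
  have := I.isMarkovKernel_imp
  have := fun n => isProbabilityMeasure_obsLaw I n
  have hr := hRC.r_nonneg
  have hpsd : ∀ c : ℝ, 0 ≤ c → (c • info⁻¹).PosSemidef := fun c hc =>
    hRC.posDef_info.inv.posSemidef.smul hc
  -- Whitening turns `N(0, c 𝒰)` into `√c` times a standard Gaussian; used with `c = 1 + r` for `𝒯`
  -- and `c = r` for `ℬ`.
  have hchar : ∀ (c : ℝ), 0 ≤ c → ∀ t,
      charFun (multivariateGaussian 0 (c • info⁻¹)) (T' t) =
        Complex.exp (-(c * ‖t‖ ^ 2 : ℝ) / 2) := by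
    intro c hc t
    rw [charFun_multivariateGaussian (hpsd c hc), Matrix.smul_mulVec, dotProduct_smul, hTT' t]
    congr 1
    simp
    ring
  have hinner : ∀ (n : ℕ) (v t : EuclideanSpace ℝ (Fin h)),
      ⟪√(n : ℝ) • T v, t⟫ = ⟪√(n : ℝ) • v, T' t⟫ := fun n v t => by
    rw [real_inner_smul_left, hT', real_inner_smul_left]
  have hz₀ : ∀ n : ℕ, Measurable fun x => √(n : ℝ) • T (e.obsMle n x - ψstar) := fun n =>
    (T.continuous.measurable.comp
      ((e.measurable_obsMle n).sub measurable_const)).const_smul (√(n : ℝ))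
  have hz : ∀ n : ℕ, Measurable fun p => √(n : ℝ) • T (e.mle n p - e.obsMle n p.1) := fun n =>
    (T.continuous.measurable.comp ((e.measurable_mle n).sub
      ((e.measurable_obsMle n).comp measurable_fst))).const_smul (√(n : ℝ))
  refine tendstoInDistribution_stack P (fun n => S.obsLaw n ψstar) I.imp I.Xobs I.Xmis
    I.measurable_Xobs I.measurable_Xmis (fun n => map_data_eq I n)
    (fun n x => √(n : ℝ) • T (e.obsMle n x - ψstar))
    (fun n p => √(n : ℝ) • T (e.mle n p - e.obsMle n p.1))
    hz₀ hz
    (√(1 + r)) (√r) (fun t => ?_) fun t ε hε => ?_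
  · have h1 := ProbabilityMeasure.tendsto_iff_tendsto_charFun.1 hRC.obsMle_normal.tendsto (T' t)
    simp only [ProbabilityMeasure.coe_mk, Measure.map_id] at h1
    rw [hRC.efmi, hchar _ (by positivity)] at h1
    rw [Real.sq_sqrt (by positivity)]
    refine h1.congr fun n => ?_
    rw [charFun_apply, ← map_Xobs_eq I n, integral_map (hRC.obsMle_normal.forall_aemeasurable n)
      (by fun_prop), integral_map (I.measurable_Xobs n).aemeasurable]
    · simp_rw [hinner]
    · refine Measurable.aestronglyMeasurable (Complex.measurable_exp.comp
        ((Complex.measurable_ofReal.comp ((hz₀ n).inner measurable_const)).mul_const _))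
  · rw [Real.sq_sqrt hr]
    have hcov : 𝒯 - info⁻¹ = r • info⁻¹ := by
      rw [hRC.efmi, add_smul, one_smul, add_sub_cancel_left]
    -- Conditional weak convergence is tested on real functions, so the complex exponential is split
    -- into cosine and sine.
    set gc : EuclideanSpace ℝ (Fin h) →ᵇ ℝ := BoundedContinuousFunction.ofNormedAddCommGroup
      (fun z => Real.cos ⟪z, T' t⟫) (by fun_prop) 1 (fun z => Real.abs_cos_le_one _) with hgc
    set gs : EuclideanSpace ℝ (Fin h) →ᵇ ℝ := BoundedContinuousFunction.ofNormedAddCommGroup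
      (fun z => Real.sin ⟪z, T' t⟫) (by fun_prop) 1 (fun z => Real.abs_sin_le_one _) with hgs
    have hlim : Complex.exp (-(r * ‖t‖ ^ 2 : ℝ) / 2) =
        ((∫ z, gc z ∂(multivariateGaussian 0 (𝒯 - info⁻¹)) : ℝ) : ℂ) +
          ((∫ z, gs z ∂(multivariateGaussian 0 (𝒯 - info⁻¹)) : ℝ) : ℂ) * Complex.I := by
      rw [← hchar r hr t, charFun_apply, ← hcov]
      exact integral_exp_inner_eq (multivariateGaussian 0 (𝒯 - info⁻¹)) measurable_id (T' t)
    have h1 := (hRC.imp_normal gc (ε / 2) (by positivity)).add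
      (hRC.imp_normal gs (ε / 2) (by positivity))
    rw [add_zero] at h1
    refine tendsto_of_tendsto_of_tendsto_of_le_of_le tendsto_const_nhds h1 (fun _ => zero_le)
      fun n => ?_
    refine (measure_mono fun x hx => ?_).trans (measure_union_le _ _)
    simp only [Set.mem_ofPred_eq] at hx
    by_contra hcon
    simp only [Set.mem_union, Set.mem_ofPred_eq, not_or, not_le] at hcon
    refine absurd hx (not_le.2 ?_)
    have hZ : Measurable fun y => √(n : ℝ) • (e.mle n (x, y) - e.obsMle n x) :=
      (((e.measurable_mle n).comp measurable_prodMk_left).sub measurable_const).const_smul (√(n : ℝ))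
    simp_rw [hinner]
    rw [integral_exp_inner_eq _ hZ, hlim]
    change ‖((∫ y, gc _ ∂_ : ℝ) : ℂ) + ((∫ y, gs _ ∂_ : ℝ) : ℂ) * Complex.I - _‖ < ε
    set A := ∫ y, gc (√(n : ℝ) • (e.mle n (x, y) - e.obsMle n x)) ∂(I.imp n x)
    set A' := ∫ z, gc z ∂(multivariateGaussian 0 (𝒯 - info⁻¹))
    set B := ∫ y, gs (√(n : ℝ) • (e.mle n (x, y) - e.obsMle n x)) ∂(I.imp n x)
    set B' := ∫ z, gs z ∂(multivariateGaussian 0 (𝒯 - info⁻¹))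
    have : (A : ℂ) + B * Complex.I - (A' + B' * Complex.I) =
        ((A - A' : ℝ) : ℂ) + ((B - B' : ℝ) : ℂ) * Complex.I := by
      push_cast
      ring
    rw [this]
    refine (norm_add_le _ _).trans_lt ?_
    rw [norm_mul, Complex.norm_I, mul_one, Complex.norm_real, Complex.norm_real, Real.norm_eq_abs,
      Real.norm_eq_abs]
    linarith [hcon.1, hcon.2]

/-- Consistency of the estimators. -/
lemma RegularityConditions.consistent (hm : 0 < m)
    (hRC : RegularityConditions S e P I θ θ₀ info 𝒯 r) (hH0 : θ ψstar = θ₀) {δ : ℝ} (hδ : 0 < δ) :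
    WithHighProb P fun n ω => (∀ ℓ, e.mle n (I.completed n ω ℓ) ∈ Metric.ball ψstar δ) ∧
      e.avgMle n (I.completed n ω) ∈ Metric.ball ψstar δ ∧
      e.avgMle₀ n (I.completed n ω) ∈ Metric.ball ψstar δ := by
  have hm' : (0 : ℝ) < m := by exact_mod_cast hm
  have hsep : ∀ ℓ, WithHighProb P fun n ω => ∀ ψ ∈ S.Ψ, δ ≤ dist ψ ψstar →
      (n : ℝ)⁻¹ * S.loglik n (I.completed n ω ℓ) ψ <
        (n : ℝ)⁻¹ * S.loglik n (I.completed n ω ℓ) ψstar := by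
    intro ℓ
    obtain ⟨d, hd, hlim⟩ := hRC.well_separated ℓ δ hδ
    refine WithHighProb.mono (p := fun n ω => ¬ ∃ ψ ∈ S.Ψ, δ ≤ dist ψ ψstar ∧
      (n : ℝ)⁻¹ * S.loglik n (I.completed n ω ℓ) ψ >
        (n : ℝ)⁻¹ * S.loglik n (I.completed n ω ℓ) ψstar - d) ?_ ?_
    · simpa only [WithHighProb, not_not] using hlim
    · refine Eventually.of_forall fun n ω hω ψ hψ hdist => ?_
      by_contra hlt
      exact hω ⟨ψ, hψ, hdist, by linarith⟩
  refine ((WithHighProb.forall hsep).and ((withHighProb_of_ae hRC.mle_completed).and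
    ((withHighProb_of_ae hRC.isMaxOn_avgMle).and
      (withHighProb_of_ae hRC.isMaxOn_avgMle₀)))).mono ?_
  filter_upwards [eventually_gt_atTop 0] with n hn ω hω
  obtain ⟨hs, hmle, havg, havg₀⟩ := hω
  have hn' : (0 : ℝ) < n := by exact_mod_cast hn
  have hs' : ∀ ℓ, ∀ ψ ∈ S.Ψ, δ ≤ dist ψ ψstar →
      S.loglik n (I.completed n ω ℓ) ψ < S.loglik n (I.completed n ω ℓ) ψstar :=
    fun ℓ ψ hψ hd => lt_of_mul_lt_mul_left (hs ℓ ψ hψ hd) (by positivity)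
  -- Outside the ball every completed-data log-likelihood lies below its value at `ψstar`, hence so
  -- does their average. The constrained maximizer does at least as well as `ψstar` because the null
  -- hypothesis holds there.
  have hL : ∀ ψ ∈ S.Ψ, S.avgLoglik n (I.completed n ω) (fun _ => ψstar) ≤
      S.avgLoglik n (I.completed n ω) (fun _ => ψ) → ψ ∈ Metric.ball ψstar δ := by
    intro ψ hψ hle
    by_contra hcon
    rw [Metric.mem_ball, not_lt] at hcon
    refine absurd hle (not_le.2 ?_)
    refine mul_lt_mul_of_pos_left ?_ (by positivity)
    exact Finset.sum_lt_sum_of_nonempty ⟨⟨0, hm⟩, Finset.mem_univ _⟩ fun ℓ _ => hs' ℓ ψ hψ hcon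
  refine ⟨fun ℓ => ?_, hL _ (e.avgMle_mem _ _) (havg hRC.ψstar_mem),
    hL _ (e.avgMle₀_mem _ _) (havg₀.2 ⟨hRC.ψstar_mem, hH0⟩)⟩
  by_contra hcon
  rw [Metric.mem_ball, not_lt] at hcon
  exact absurd ((hmle ℓ).2.1 hRC.ψstar_mem) (not_le.2 (hs' ℓ _ (hmle ℓ).1 hcon))

/-- The information matrices of the completed data at the estimators are consistent. -/
lemma RegularityConditions.obsInfo_mle_near
    (hRC : RegularityConditions S e P I θ θ₀ info 𝒯 r) {τ : ℝ} (hτ : 0 < τ) :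
    WithHighProb P fun n ω => ∀ ℓ i j, |S.obsInfo n (I.completed n ω ℓ)
      (e.mle n (I.completed n ω ℓ)) i j - info i j| ≤ τ := by
  have hr := hRC.r_nonneg
  have hdet : IsUnit info.det := (Matrix.isUnit_iff_isUnit_det _).1 hRC.posDef_info.isUnit
  have hdetT : IsUnit 𝒯.det := by
    have : 𝒯.PosDef := by
      rw [hRC.efmi]
      exact hRC.posDef_info.inv.smul (by positivity)
    exact (Matrix.isUnit_iff_isUnit_det _).1 this.isUnit
  obtain ⟨ε, hε, hnear⟩ := exists_inverse_near hdet hdetT hτ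
  have h1 : WithHighProb P fun n ω => ∀ ℓ i j, |(𝒯⁻¹ * ((S.obsInfo n (I.completed n ω ℓ)
      (e.mle n (I.completed n ω ℓ)))⁻¹ - info⁻¹)) i j| < ε :=
    WithHighProb.forall fun ℓ => WithHighProb.forall fun i => WithHighProb.forall fun j => by
      simpa only [WithHighProb, not_lt] using hRC.imp_lower_order ℓ i j ε hε
  exact h1.mono (Eventually.of_forall fun n ω hω ℓ => hnear _ (hω ℓ))

end Model

/-! ### Comparison of the statistic with its limiting functional -/

section Main

variable {h k m : ℕ} {𝒪 ℳ : ℕ → Type*} [∀ n, MeasurableSpace (𝒪 n)] [∀ n, MeasurableSpace (ℳ n)]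
  {S : SamplingModel h 𝒪 ℳ} {e : Estimators S m} {ψstar : EuclideanSpace ℝ (Fin h)}
  {Ω : ℕ → Type*} [∀ n, MeasurableSpace (Ω n)] {P : ∀ n, Measure (Ω n)}
  [∀ n, IsProbabilityMeasure (P n)] {I : MultipleImputation S m ψstar P}
  {θ : EuclideanSpace ℝ (Fin h) → EuclideanSpace ℝ (Fin k)} {θ₀ : EuclideanSpace ℝ (Fin k)}
  {info 𝒯 : Matrix (Fin h) (Fin h) ℝ} {r : ℝ}

/-- The tangent space of the null hypothesis in whitened coordinates. -/
def nullTangent (θ : EuclideanSpace ℝ (Fin h) → EuclideanSpace ℝ (Fin k))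
    (ψstar : EuclideanSpace ℝ (Fin h))
    (T : EuclideanSpace ℝ (Fin h) ≃L[ℝ] EuclideanSpace ℝ (Fin h)) :
    Submodule ℝ (EuclideanSpace ℝ (Fin h)) :=
  ((fderiv ℝ θ ψstar).comp (T.symm : EuclideanSpace ℝ (Fin h) →L[ℝ] EuclideanSpace ℝ (Fin h))).ker

lemma surjective_fderiv_comp_symm (hRC : RegularityConditions S e P I θ θ₀ info 𝒯 r)
    (T : EuclideanSpace ℝ (Fin h) ≃L[ℝ] EuclideanSpace ℝ (Fin h)) :
    Function.Surjective ((fderiv ℝ θ ψstar).comp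
      (T.symm : EuclideanSpace ℝ (Fin h) →L[ℝ] EuclideanSpace ℝ (Fin h))) :=
  hRC.surjective_fderiv_θ.comp T.symm.surjective

/-- Rank-nullity for a surjection onto `ℝ^k`; this is the number of degrees of freedom of `M₁`. -/
lemma finrank_nullTangent_orthogonal (hRC : RegularityConditions S e P I θ θ₀ info 𝒯 r)
    (T : EuclideanSpace ℝ (Fin h) ≃L[ℝ] EuclideanSpace ℝ (Fin h)) :
    Module.finrank ℝ (nullTangent θ ψstar T)ᗮ = k := by
  have h1 := (nullTangent θ ψstar T).finrank_add_finrank_orthogonal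
  have h2 := LinearMap.finrank_range_add_finrank_ker ((fderiv ℝ θ ψstar).comp
    (T.symm : EuclideanSpace ℝ (Fin h) →L[ℝ] EuclideanSpace ℝ (Fin h))).toLinearMap
  rw [LinearMap.range_eq_top.2 (surjective_fderiv_comp_symm hRC T), finrank_top,
    finrank_euclideanSpace_fin] at h2
  change k + Module.finrank ℝ (nullTangent θ ψstar T) = _ at h2
  omega

lemma hasStrictFDerivAt_comp_symm (hRC : RegularityConditions S e P I θ θ₀ info 𝒯 r)
    (T : EuclideanSpace ℝ (Fin h) ≃L[ℝ] EuclideanSpace ℝ (Fin h)) :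
    HasStrictFDerivAt (fun x => θ (T.symm x)) ((fderiv ℝ θ ψstar).comp
      (T.symm : EuclideanSpace ℝ (Fin h) →L[ℝ] EuclideanSpace ℝ (Fin h))) (T ψstar) := by
  have h1 : HasStrictFDerivAt θ (fderiv ℝ θ ψstar) (T.symm (T ψstar)) := by
    rw [T.symm_apply_apply]
    exact hRC.contDiffAt_θ.hasStrictFDerivAt (by norm_num)
  exact h1.comp (T ψstar)
    (T.symm : EuclideanSpace ℝ (Fin h) →L[ℝ] EuclideanSpace ℝ (Fin h)).hasStrictFDerivAt

lemma exists_nullTangent_near (hRC : RegularityConditions S e P I θ θ₀ info 𝒯 r)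
    (hH0 : θ ψstar = θ₀) (T : EuclideanSpace ℝ (Fin h) ≃L[ℝ] EuclideanSpace ℝ (Fin h))
    {ρ : ℝ} (hρ : 0 < ρ) :
    ∃ δ > 0, ∀ ψ ∈ Metric.ball ψstar δ, θ ψ = θ₀ →
      ∃ w ∈ nullTangent θ ψstar T, ‖T (ψ - ψstar) - w‖ ≤ ρ * ‖T (ψ - ψstar)‖ := by
  obtain ⟨δ, hδ, hnear⟩ := exists_ker_near_of_level (hasStrictFDerivAt_comp_symm hRC T)
    (surjective_fderiv_comp_symm hRC T) hρ
  set C := ‖(T : EuclideanSpace ℝ (Fin h) →L[ℝ] EuclideanSpace ℝ (Fin h))‖ with hC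
  refine ⟨δ / (C + 1), by positivity, fun ψ hψ hθ => hnear _ ?_ ?_⟩
  · rw [mem_ball_iff_norm, lt_div_iff₀ (by positivity)] at hψ
    have := (T : EuclideanSpace ℝ (Fin h) →L[ℝ] EuclideanSpace ℝ (Fin h)).le_opNorm (ψ - ψstar)
    rw [ContinuousLinearEquiv.coe_coe] at this
    nlinarith [norm_nonneg (ψ - ψstar)]
  · simp [hθ, hH0]

lemma exists_null_near (hRC : RegularityConditions S e P I θ θ₀ info 𝒯 r)
    (hH0 : θ ψstar = θ₀) (T : EuclideanSpace ℝ (Fin h) ≃L[ℝ] EuclideanSpace ℝ (Fin h))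
    {ρ δ : ℝ} (hρ : 0 < ρ) (hδ : 0 < δ) :
    ∃ δ' > 0, ∀ w ∈ nullTangent θ ψstar T, ‖w‖ < δ' →
      ∃ ψ ∈ Metric.ball ψstar δ, θ ψ = θ₀ ∧ ‖T (ψ - ψstar) - w‖ ≤ ρ * ‖w‖ := by
  obtain ⟨δ₁, hδ₁, hnear⟩ := exists_level_near_of_ker (hasStrictFDerivAt_comp_symm hRC T)
    (surjective_fderiv_comp_symm hRC T) hρ
  set C := ‖(T.symm : EuclideanSpace ℝ (Fin h) →L[ℝ] EuclideanSpace ℝ (Fin h))‖ with hC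
  -- The point found has norm at most `(1 + ρ) ‖w‖`, and undoing the whitening costs a factor at
  -- most `C`; so it lands in the ball of radius `δ`.
  refine ⟨min δ₁ (δ / ((C + 1) * (1 + ρ))), by positivity, fun w hw hwδ => ?_⟩
  obtain ⟨x, hx, hxw⟩ := hnear w hw (hwδ.trans_le (min_le_left _ _))
  have hw2 := hwδ.trans_le (min_le_right _ _)
  rw [lt_div_iff₀ (by positivity)] at hw2
  refine ⟨ψstar + T.symm x, ?_, ?_, ?_⟩
  · rw [mem_ball_iff_norm, add_sub_cancel_left]
    have h1 := (T.symm : EuclideanSpace ℝ (Fin h) →L[ℝ] EuclideanSpace ℝ (Fin h)).le_opNorm x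
    rw [ContinuousLinearEquiv.coe_coe] at h1
    have h2 : ‖x‖ ≤ (1 + ρ) * ‖w‖ := by
      have : x = (x - w) + w := by abel
      rw [this]
      refine (norm_add_le _ _).trans ?_
      linarith
    calc ‖T.symm x‖ ≤ C * ‖x‖ := h1
      _ ≤ (C + 1) * ((1 + ρ) * ‖w‖) := by gcongr; linarith
      _ = ‖w‖ * ((C + 1) * (1 + ρ)) := by ring
      _ < δ := hw2
  · simpa [hH0] using hx
  · simpa using hxw

/-- The statistic differs from its asymptotic form by a term that tends to zero in probability. -/
lemma tendsto_DHatRob_sub (hk : 0 < k) (hm : 1 < m)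
    (hRC : RegularityConditions S e P I θ θ₀ info 𝒯 r) (hH0 : θ ψstar = θ₀)
    (T : EuclideanSpace ℝ (Fin h) ≃L[ℝ] EuclideanSpace ℝ (Fin h))
    (hT : ∀ v, ‖T v‖ ^ 2 = v.ofLp ⬝ᵥ info.mulVec v.ofLp)
    (htight : ∀ η : ℝ≥0∞, 0 < η → ∃ K, 0 < K ∧ ∀ n : ℕ,
      P n {ω | ¬ ∀ ℓ, ‖√(n : ℝ) • T (e.mle n (I.completed n ω ℓ) - ψstar)‖ ≤ K} ≤ η)
    {ε : ℝ} (hε : 0 < ε) :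
    Tendsto (fun n : ℕ => P n {ω | ε ≤ ‖e.DHatRob k n (I.completed n ω) -
      limitStat (nullTangent θ ψstar T) k (((m : ℝ) + 1) / ((h : ℝ) * ((m : ℝ) - 1)))
        fun ℓ => √(n : ℝ) • T (e.mle n (I.completed n ω ℓ) - ψstar)‖}) atTop (𝓝 0) := by
  have hm0 : 0 < m := by omega
  set c : ℝ := ((m : ℝ) + 1) / ((h : ℝ) * ((m : ℝ) - 1)) with hc
  have hc0 : 0 ≤ c := by
    have : (1 : ℝ) < m := by exact_mod_cast hm
    exact div_nonneg (by positivity) (mul_nonneg (by positivity) (by linarith))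
  rw [ENNReal.tendsto_nhds_zero]
  intro η₀ hη₀
  -- The exceptional event has `m + 2` parts: one for consistency and the almost sure properties,
  -- one for tightness, and one for the equicontinuity of each completed data set.
  obtain ⟨η, hη, hηη₀⟩ : ∃ η : ℝ≥0∞, 0 < η ∧ (m + 2 : ℝ≥0∞) * η ≤ η₀ := by
    refine ⟨η₀ / (m + 2), ENNReal.div_pos hη₀.ne' (by finiteness), ?_⟩
    exact ENNReal.mul_div_le
  obtain ⟨K, hK, hKη⟩ := htight η hη
  -- The two terms come from `abs_ratio_sub_le`: error `42ρK²` in `d̂`, and error `ρK²` in the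
  -- spread weighted by `c` and by `|d'| ≤ K²`.
  obtain ⟨ρ, hρ, hρ2, hρε⟩ : ∃ ρ : ℝ, 0 < ρ ∧ ρ ≤ 1 / 2 ∧
      ρ * (42 * K ^ 2 + K ^ 2 * (c * K ^ 2)) < ε := by
    have hB : 0 < 42 * K ^ 2 + K ^ 2 * (c * K ^ 2) + 1 := by positivity
    refine ⟨min (1 / 2) (ε / (42 * K ^ 2 + K ^ 2 * (c * K ^ 2) + 1)), by positivity,
      min_le_left _ _, ?_⟩
    calc _ ≤ ε / (42 * K ^ 2 + K ^ 2 * (c * K ^ 2) + 1) *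
        (42 * K ^ 2 + K ^ 2 * (c * K ^ 2)) := by
          gcongr
          exact min_le_right _ _
      _ < ε / (42 * K ^ 2 + K ^ 2 * (c * K ^ 2) + 1) *
        (42 * K ^ 2 + K ^ 2 * (c * K ^ 2) + 1) :=
          mul_lt_mul_of_pos_left (lt_add_one _) (by positivity)
      _ = ε := by field_simp
  set C : ℝ := (h : ℝ) ^ 2 *
    ‖(T.symm : EuclideanSpace ℝ (Fin h) →L[ℝ] EuclideanSpace ℝ (Fin h))‖ ^ 2 with hC
  have hC0 : 0 ≤ C := by positivity
  -- The information at `ψ` reaches `info` in three steps of size `τ`: to `ψstar`, to the estimator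
  -- by equicontinuity again, and to the limit by proper imputation.
  obtain ⟨τ, hτ, hτρ⟩ : ∃ τ : ℝ, 0 < τ ∧ C * (3 * τ) ≤ ρ := by
    refine ⟨ρ / (3 * (C + 1)), by positivity, ?_⟩
    rw [show C * (3 * (ρ / (3 * (C + 1)))) = ρ * (C / (C + 1)) by field_simp]
    refine mul_le_of_le_one_right hρ.le ?_
    rw [div_le_one (by positivity)]
    linarith
  obtain ⟨δ₁, hδ₁, hball⟩ := Metric.isOpen_iff.1 S.isOpen_Ψ ψstar hRC.ψstar_mem
  obtain ⟨δ₂, hδ₂, hN⟩ := exists_nullTangent_near hRC hH0 T hρ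
  choose δ₃ hδ₃ hequi using fun ℓ => hRC.obsInfo_equicontinuous ℓ τ hτ η hη
  obtain ⟨δ₄, hδ₄, hδ₄le⟩ : ∃ δ₄ > 0, ∀ ℓ, δ₄ ≤ δ₃ ℓ := by
    have hne : (Finset.univ : Finset (Fin m)).Nonempty := ⟨⟨0, hm0⟩, Finset.mem_univ _⟩
    refine ⟨Finset.univ.inf' hne δ₃, (Finset.lt_inf'_iff hne).2 fun ℓ _ => hδ₃ ℓ,
      fun ℓ => Finset.inf'_le _ (Finset.mem_univ ℓ)⟩
  set δ := min δ₁ (min δ₂ δ₄) with hδdef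
  have hδ : 0 < δ := by positivity
  have hδ1 : δ ≤ δ₁ := min_le_left _ _
  have hδ2 : δ ≤ δ₂ := (min_le_right _ _).trans (min_le_left _ _)
  have hδ4 : δ ≤ δ₄ := (min_le_right _ _).trans (min_le_right _ _)
  obtain ⟨δ', hδ', hN'⟩ := exists_null_near hRC hH0 T hρ hδ
  have hwhp := (hRC.consistent hm0 hH0 hδ).and ((hRC.obsInfo_mle_near hτ).and
    ((withHighProb_of_ae hRC.mle_completed).and ((withHighProb_of_ae hRC.isMaxOn_avgMle).and
      (withHighProb_of_ae hRC.isMaxOn_avgMle₀))))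
  have hsmall : ∀ᶠ n : ℕ in atTop, K / √(n : ℝ) < δ' := by
    have : Tendsto (fun n : ℕ => K / √(n : ℝ)) atTop (𝓝 0) :=
      (Real.tendsto_sqrt_atTop.comp tendsto_natCast_atTop_atTop).const_div_atTop K
    exact this.eventually_lt_const hδ'
  filter_upwards [ENNReal.tendsto_nhds_zero.1 hwhp η hη, eventually_all.2 hequi, hsmall,
    eventually_gt_atTop 0] with n hn1 hn2 hn3 hn
  set E : Fin m → Set (Ω n) := fun ℓ => {ω | ∃ ψ ∈ S.Ψ, dist ψ ψstar < δ₃ ℓ ∧ ∃ i j,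
    τ ≤ |S.obsInfo n (I.completed n ω ℓ) ψ i j - S.obsInfo n (I.completed n ω ℓ) ψstar i j|} with hE
  have hbound := (measure_union_le _ _).trans ((add_le_add hn1 ((measure_union_le _ _).trans
    (add_le_add (hKη n) ((measure_iUnion_fintype_le _ E).trans
      (Finset.sum_le_sum fun ℓ _ => hn2 ℓ))))).trans (le_trans (le_of_eq (by
        simp only [Finset.sum_const, Finset.card_univ, Fintype.card_fin, nsmul_eq_mul]
        ring)) hηη₀))
  refine le_trans (measure_mono fun ω hω => ?_) hbound
  by_contra hcon
  simp only [Set.mem_union, Set.mem_ofPred_eq, Set.mem_iUnion, not_or, not_not, not_exists] at hcon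
  obtain ⟨hpω, hKω, hEω⟩ := hcon
  obtain ⟨⟨hb, hb', hb₀⟩, hmleinfo, hmle, havg, havg₀⟩ := hpω
  have hequi' : ∀ ℓ, ∀ ψ ∈ Metric.ball ψstar δ, ∀ i j,
      |S.obsInfo n (I.completed n ω ℓ) ψ i j - S.obsInfo n (I.completed n ω ℓ) ψstar i j| < τ := by
    intro ℓ ψ hψ i j
    by_contra hlt
    exact hEω ℓ ⟨ψ, hball (Metric.ball_subset_ball hδ1 hψ),
      (Metric.mem_ball.1 hψ).trans_le (hδ4.trans (hδ₄le ℓ)), i, j, not_lt.1 hlt⟩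
  have hinfo : ∀ ℓ, ∀ ψ ∈ Metric.ball ψstar δ, ∀ i j,
      |S.obsInfo n (I.completed n ω ℓ) ψ i j - info i j| ≤ 3 * τ := by
    intro ℓ ψ hψ i j
    have h1 := abs_lt.1 (hequi' ℓ ψ hψ i j)
    have h2 := abs_lt.1 (hequi' ℓ _ (hb ℓ) i j)
    have h3 := abs_le.1 (hmleinfo ℓ i j)
    rw [abs_le]
    constructor <;> linarith [h1.1, h1.2, h2.1, h2.2, h3.1, h3.2]
  obtain ⟨hd, hV, hV0⟩ := statistics_near hm0 e hn (I.completed n ω) hH0 T hT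
    (nullTangent θ ψstar T) hρ.le hρ2 hδ ((Metric.ball_subset_ball hδ1).trans hball)
    (fun ℓ => hRC.contDiffOn_loglik n _) hmle havg havg₀ hb hb' hb₀ (by positivity) hτρ hinfo hKω
    (fun ψ hψ => hN ψ (Metric.ball_subset_ball hδ2 hψ))
    (fun w hw hwK => hN' w hw (hwK.trans_lt hn3))
  rw [Set.mem_ofPred_eq] at hω
  refine absurd hω (not_le.2 ?_)
  set a : Fin m → EuclideanSpace ℝ (Fin h) :=
    fun ℓ => √(n : ℝ) • T (e.mle n (I.completed n ω ℓ) - ψstar) with ha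
  set d' := ‖mean a - (nullTangent θ ψstar T).starProjection (mean a)‖ ^ 2 with hd'
  have hd'K : |d'| ≤ K ^ 2 := by
    rw [abs_of_nonneg (by positivity), hd', ← Submodule.starProjection_orthogonal_val]
    gcongr
    exact (Submodule.norm_starProjection_apply_le _ _).trans (norm_mean_le hm0 hKω)
  have := abs_ratio_sub_le hk (d := e.dHat n (I.completed n ω)) (d' := d') hc0 hV0
    (spread_nonneg a)
  rw [Real.norm_eq_abs]
  refine this.trans_lt (lt_of_le_of_lt ?_ hρε)
  have h4 : |d'| * (c * |e.deltaBar n (I.completed n ω) - e.deltaHat n (I.completed n ω) -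
      spread a|) ≤ K ^ 2 * (c * (ρ * K ^ 2)) := by gcongr
  calc _ ≤ 42 * ρ * K ^ 2 + K ^ 2 * (c * (ρ * K ^ 2)) := add_le_add hd h4
    _ = _ := by ring

end Main

end MILRT

end

theorem mainTheorem2 {h k m : ℕ} (hk : 0 < k) (hm : 1 < m)
    {𝒪 ℳ : ℕ → Type*} [∀ n, MeasurableSpace (𝒪 n)] [∀ n, MeasurableSpace (ℳ n)]
    (S : MILRT.SamplingModel h 𝒪 ℳ) (e : MILRT.Estimators S m)
    (ψstar : EuclideanSpace ℝ (Fin h))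
    {Ω : ℕ → Type*} [∀ n, MeasurableSpace (Ω n)]
    (P : ∀ n, Measure (Ω n)) [∀ n, IsProbabilityMeasure (P n)]
    (I : MILRT.MultipleImputation S m ψstar P)
    (θ : EuclideanSpace ℝ (Fin h) → EuclideanSpace ℝ (Fin k)) (θ₀ : EuclideanSpace ℝ (Fin k))
    (info 𝒯 : Matrix (Fin h) (Fin h) ℝ) (r : ℝ)
    (hRC : MILRT.RegularityConditions S e P I θ θ₀ info 𝒯 r)
    (hH0 : θ ψstar = θ₀)
    {Ω' : Type*} [MeasurableSpace Ω'] (P' : Measure Ω') [IsProbabilityMeasure P']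
    (M₁ M₃ : Ω' → ℝ)
    (hM₁ : HasLaw M₁ ((MILRT.chiSquared k).map (fun t => t / (k : ℝ))) P')
    (hM₃ : HasLaw M₃ ((MILRT.chiSquared (h * (m - 1))).map
      (fun t => t / ((h * (m - 1) : ℕ) : ℝ))) P')
    (hM : IndepFun M₁ M₃ P') :
    TendstoInDistribution (fun n ω => e.DHatRob k n (I.completed n ω)) atTop
      (fun ω => (1 + (1 + 1 / (m : ℝ)) * r) * M₁ ω / (1 + (1 + 1 / (m : ℝ)) * r * M₃ ω)) P P' := by
  have hm0 : 0 < m := by omega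
  have hr := hRC.r_nonneg
  -- `ℝ^h` maps onto `ℝ^k` with `k > 0`.
  have hh : 0 < h := by
    have h1 := LinearMap.finrank_le_finrank_of_surjective
      (f := (fderiv ℝ θ ψstar).toLinearMap) hRC.surjective_fderiv_θ
    rw [finrank_euclideanSpace_fin, finrank_euclideanSpace_fin] at h1
    omega
  have hc0 : 0 ≤ ((m : ℝ) + 1) / ((h : ℝ) * ((m : ℝ) - 1)) := by
    have : (1 : ℝ) < m := by exact_mod_cast hm
    exact div_nonneg (by positivity) (mul_nonneg (by positivity) (by linarith))
  obtain ⟨T, T', hT, hT', hTT'⟩ := MILRT.exists_whitening hRC.posDef_info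
  have hstack := hRC.tendsto_stack T T' hT' hTT'
  have hadd : ∀ (n : ℕ) ω (ℓ : Fin m), MILRT.stackMk
      (√(n : ℝ) • T (e.obsMle n (I.Xobs n ω) - ψstar)) (fun ℓ : Fin m =>
        √(n : ℝ) • T (e.mle n (I.completed n ω ℓ) - e.obsMle n (I.Xobs n ω))) none +
      MILRT.stackMk (√(n : ℝ) • T (e.obsMle n (I.Xobs n ω) - ψstar)) (fun ℓ : Fin m =>
        √(n : ℝ) • T (e.mle n (I.completed n ω ℓ) - e.obsMle n (I.Xobs n ω))) (some ℓ) =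
      √(n : ℝ) • T (e.mle n (I.completed n ω ℓ) - ψstar) := by
    intro n ω ℓ
    simp only [MILRT.stackMk, Option.elim]
    rw [← smul_add, ← map_add, add_comm, sub_add_sub_cancel]
  have hlim := hstack.continuous_comp
    (MILRT.continuous_limitStat (MILRT.nullTangent θ ψstar T) hk hc0)
  have hmeas : ∀ n, Measurable fun ω => e.DHatRob k n (I.completed n ω) := fun n =>
    (MILRT.measurable_DHatRob (hRC.contDiffOn_loglik n) e k).comp
      (measurable_pi_lambda _ fun ℓ => (I.measurable_Xobs n).prodMk (I.measurable_Xmis n ℓ))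
  have hmain := MILRT.tendstoInDistribution_of_tendsto_measure_sub hlim
    (Y := fun n ω => e.DHatRob k n (I.completed n ω)) (fun n => (hmeas n).aemeasurable)
    fun ε hε => by
      simp only [Function.comp, hadd]
      refine MILRT.tendsto_DHatRob_sub hk hm hRC hH0 T hT (fun η hη => ?_) hε
      obtain ⟨K, hK, hKη⟩ := MILRT.exists_norm_bound_of_tendstoInDistribution hstack hη
      -- Each standardized estimator is the sum of two components of the stack, each bounded by its
      -- norm.
      refine ⟨2 * K, by positivity, fun n => (measure_mono fun ω hω => ?_).trans (hKη n)⟩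
      by_contra hcon
      simp only [Set.mem_ofPred_eq, not_lt] at hcon
      refine hω fun ℓ => ?_
      rw [← hadd]
      refine (norm_add_le _ _).trans ?_
      have h1 := PiLp.norm_apply_le (MILRT.stackMk
        (√(n : ℝ) • T (e.obsMle n (I.Xobs n ω) - ψstar)) (fun ℓ : Fin m =>
          √(n : ℝ) • T (e.mle n (I.completed n ω ℓ) - e.obsMle n (I.Xobs n ω)))) none
      have h2 := PiLp.norm_apply_le (MILRT.stackMk
        (√(n : ℝ) • T (e.obsMle n (I.Xobs n ω) - ψstar)) (fun ℓ : Fin m =>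
          √(n : ℝ) • T (e.mle n (I.completed n ω ℓ) - e.obsMle n (I.Xobs n ω)))) (some ℓ)
      linarith
  have hlaw := MILRT.map_limitStat_eq (E := EuclideanSpace ℝ (Fin h)) hm
    (MILRT.nullTangent θ ψstar T) (MILRT.finrank_nullTangent_orthogonal hRC T)
    (by rwa [finrank_euclideanSpace_fin]) hr hM₁ (by rwa [finrank_euclideanSpace_fin]) hM
  rw [finrank_euclideanSpace_fin] at hlaw
  have hM₁m := hM₁.aemeasurable
  have hM₃m := hM₃.aemeasurable
  refine ⟨hmain.forall_aemeasurable, by fun_prop, ?_⟩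
  have ht := hmain.tendsto
  convert ht using 3
  exact congrArg 𝓝 (Subtype.ext hlaw)
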